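/- **Games.** All graphs are finite, undirected, without multiple edges, and reflexive (every vertex has a loop); each edge, loops included, is designated *protected* or *unprotected*. In *Cops and Robbers with protection*, $k$ cops first choose starting vertices, then the robber chooses his. In each round every cop traverses an edge (possibly a loop, i.e. she stays), and then the robber does the same. The cops win if on one of their turns some cop arrives at the robber's vertex by traversing an unprotected edge; the robber wins if this never happens. In *Lazy Cops and Robbers with protection* the rules are the same, except that on each turn at most one cop may move to a new vertex. The instances of the decision problems C&RP and LC&RP are the pairs $(G,k)$ with $G$ such a graph and $k\ge 1$ an integer; the question is whether $k$ cops have a winning strategy on $G$ in the respective game. An instance is written as $k$ in binary followed by the matrix that records, for each pair of vertices, whether it is a non-edge, a protected edge or an unprotected edge. **The graph $G'$.** For a graph $G$ as above and $k\ge 2$, let $G'$ be the following graph. Its vertices are: $v_C^i$ for $v\in V(G)$, $1\le i\le k$ (for fixed $v$ these form the *branch clique* of $v$); a *subdivision vertex* $e_C$ for each $e\in E(G)$ (loops included); $v_R$ for $v\in V(G)$; $e_L$ for $e\in E(G)$; $r_1,\dots,r_k$ (the *reset clique*); and $\omega$. Besides a loop at every vertex, its edges are: - $v_C^iv_C^j$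 for all $v$ and $i\neq j$, and $v_C^ie_C$ whenever $v$ is an endpoint of $e$; - $u_Rv_R$ for $uv\in E(G)$; $e_Lf_L$ whenever $e\ne f$ share an endpoint; $v_Re_L$ whenever $v$ is an endpoint of $e$; - $u_C^iv_R$ and $v_C^iu_R$ for $uv\in E(G)$ (loops included) and all $i$; - $e_Cv_R$ for all $e$ and $v$; $v_C^1e_L$ for all $v$ and $e$; - $r_ir_j$ for all $i\neq j$; $r_iv_C^i$ for all $v$ and $i$; $r_1e_C$ for all $e$; $r_iv_R$ and $r_ie_L$ for all $i$, $v$, $e$; - edges from $\omega$ to all vertices $v_C^i$, $e_C$, $v_R$, $e_L$. The edges $u_C^iv_R$ and $v_C^iu_R$ are protected exactly when $uv$ is protected in $G$. The loops at $r_1,\dots,r_k$ and the edges $r_ir_j$, $r_iv_R$, $r_ie_L$ are protected. All other edges and loops of $G'$ are unprotected. **Theorem 2.2.** (1) For every such graph $G$ and every $k\ge 2$, $k$ cops can win Lazy Cops and Robbers with protection on $G$ if and only if $k$ cops can win Cops and Robbers with protection on $G'$. (2) LC&RP reduces to C&RP in polynomial time. More precisely, there is a map $f$ on instances, computable by a Turing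 machine in polynomial time, such that $(G,k)$ is a yes-instance of LC&RP if and only if $f(G,k)$ is a yes-instance of C&RP. Moreover $f$ leaves the number $k$ of cops unchanged, the graph of $f(G,k)$ is isomorphic to $G$ if $k=1$, and it is isomorphic to $G'$ if $2\le k\le |V(G)|$. -/

import Mathlib

/-- The three possible statuses of an unordered pair of (possibly equal) vertices. -/
inductive EdgeKind where
  | absent
  | prot
  | unprot
  deriving DecidableEq

instance : Fintype EdgeKind :=
  ⟨{EdgeKind.absent, EdgeKind.prot, EdgeKind.unprot}, fun a => by cases a <;> decide⟩

/-- An undirected reflexive graph (every vertex carries a loop, no multiple edges) on the vertex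
type `V`, each edge of which is designated either protected or unprotected.
A vertex is called protected or unprotected according to its loop. -/
structure ProtGraph (V : Type*) where
  kind : V → V → EdgeKind
  kind_symm : ∀ u v, kind u v = kind v u
  kind_self : ∀ v, kind v v ≠ EdgeKind.absent

namespace ProtGraph

/-- `u` and `v` are joined by an edge (protected or not). -/
def Adj {V : Type*} (G : ProtGraph V) (u v : V) : Prop := G.kind u v ≠ EdgeKind.absent

/-- `u` and `v` are joined by an unprotected edge. -/
def Unprot {V : Type*} (G : ProtGraph V) (u v : V) : Prop := G.kind u v = EdgeKind.unprot

/-- The edges of `G`, loops included, as unordered pairs. -/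
def edgeSet {V : Type*} (G : ProtGraph V) : Set (Sym2 V) := {e | ∃ u v, G.Adj u v ∧ e = s(u, v)}

/-- Isomorphism of graphs with protection. -/
def Isomorphic {V W : Type*} (G : ProtGraph V) (H : ProtGraph W) : Prop :=
  ∃ φ : V ≃ W, ∀ u v, H.kind (φ u) (φ v) = G.kind u v

/-! ### The games -/

/-- A legal turn of the cops in Cops and Robbers with protection: each cop traverses an edge;
staying in place is the traversal of the loop. -/
def CopMove {V : Type*} (G : ProtGraph V) {k : ℕ} (c c' : Fin k → V) : Prop :=
  ∀ i, G.Adj (c i) (c' i)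

/-- A legal turn of the cops in the lazy variant: moreover at most one cop changes her vertex. -/
def LazyCopMove {V : Type*} (G : ProtGraph V) {k : ℕ} (c c' : Fin k → V) : Prop :=
  G.CopMove c c' ∧ ∀ i j, c i ≠ c' i → c j ≠ c' j → i = j

/-- The cops' turn from `c` to `c'` captures a robber standing on `r`: some cop comes to `r` along
an unprotected edge (possibly the loop at `r`). -/
def Captures {V : Type*} (G : ProtGraph V) {k : ℕ} (c c' : Fin k → V) (r : V) : Prop :=
  ∃ i, c' i = r ∧ G.Unprot (c i) (c' i)

/-- The cops can win on `G` when their turns have to obey `legal`.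
A strategy `σ` of the cops gives their positions as a function of the robber's positions so far:
they start on `σ []`, and when the robber has started on `r 0` and moved to `r 1, …, r t`, they
answer with the turn from `σ [r 0, …, r (t - 1)]` to `σ [r 0, …, r t]`. The strategy is winning if,
whatever walk `r` the robber makes, these turns are legal and one of them captures the robber. -/
def CopsCanWin {V : Type*} (G : ProtGraph V) (k : ℕ)
    (legal : (Fin k → V) → (Fin k → V) → Prop) : Prop :=
  ∃ σ : List V → Fin k → V, ∀ r : ℕ → V, (∀ t, G.Adj (r t) (r (t + 1))) →
    (∀ t, legal (σ ((List.range t).map r)) (σ ((List.range (t + 1)).map r))) ∧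
    ∃ t, G.Captures (σ ((List.range t).map r)) (σ ((List.range (t + 1)).map r)) (r t)

/-- `k` cops can capture a robber on `G` in Cops and Robbers with protection. -/
def CopsWin {V : Type*} (G : ProtGraph V) (k : ℕ) : Prop := G.CopsCanWin k G.CopMove

/-- `k` cops can capture a robber on `G` in Lazy Cops and Robbers with protection. -/
def LazyCopsWin {V : Type*} (G : ProtGraph V) (k : ℕ) : Prop := G.CopsCanWin k G.LazyCopMove

/-! ### The graph `G'` -/

/-- The vertices of `G'`: the branch cliques and the subdivision vertices (which form `G_C`), the
vertices of `G_R`, the vertices of `L_R`, the reset clique, and the vertex `ω`.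
The index written `i` in mathematics, `1 ≤ i ≤ k`, is `i - 1 : Fin k` here. -/
inductive GadgetVertex {V : Type*} (G : ProtGraph V) (k : ℕ) where
  | branch (v : V) (i : Fin k)
  | subdiv (e : G.edgeSet)
  | rob (v : V)
  | line (e : G.edgeSet)
  | reset (i : Fin k)
  | omega

open Classical in
/-- The edges of `G'` and their protection. -/
noncomputable def gadgetKind {V : Type*} (G : ProtGraph V) (k : ℕ) :
    G.GadgetVertex k → G.GadgetVertex k → EdgeKind
  -- inside `G_C`
  | .branch u _, .branch v _ => if u = v then .unprot else .absent
  | .branch u _, .subdiv e => if u ∈ e.1 then .unprot else .absent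
  | .subdiv e, .branch u _ => if u ∈ e.1 then .unprot else .absent
  | .subdiv e, .subdiv f => if e = f then .unprot else .absent
  -- inside `G_R`, a copy of `G` without protection
  | .rob u, .rob v => if G.Adj u v then .unprot else .absent
  -- inside `L_R`, the line graph of `G`
  | .line e, .line f => if ∃ v, v ∈ e.1 ∧ v ∈ f.1 then .unprot else .absent
  -- between `G_R` and `L_R`
  | .rob u, .line e => if u ∈ e.1 then .unprot else .absent
  | .line e, .rob u => if u ∈ e.1 then .unprot else .absent
  -- between `G_C` and `G_R`
  | .branch u _, .rob v => G.kind u v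
  | .rob u, .branch v _ => G.kind u v
  | .subdiv _, .rob _ => .unprot
  | .rob _, .subdiv _ => .unprot
  -- between `G_C` and `L_R`: the branch vertices of index 1
  | .branch _ i, .line _ => if i.val = 0 then .unprot else .absent
  | .line _, .branch _ i => if i.val = 0 then .unprot else .absent
  | .subdiv _, .line _ => .absent
  | .line _, .subdiv _ => .absent
  -- the reset clique; subdivision vertices count as vertices of index 1
  | .reset _, .reset _ => .prot
  | .reset i, .branch _ j => if i = j then .unprot else .absent
  | .branch _ i, .reset j => if i = j then .unprot else .absent
  | .reset i, .subdiv _ => if i.val = 0 then .unprot else .absent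
  | .subdiv _, .reset i => if i.val = 0 then .unprot else .absent
  | .reset _, .rob _ => .prot
  | .rob _, .reset _ => .prot
  | .reset _, .line _ => .prot
  | .line _, .reset _ => .prot
  -- the vertex `ω`
  | .omega, .reset _ => .absent
  | .reset _, .omega => .absent
  | .omega, _ => .unprot
  | _, .omega => .unprot

/-- The graph `G'` built from `G` for `k` cops. -/
noncomputable def gadget {V : Type*} (G : ProtGraph V) (k : ℕ) : ProtGraph (G.GadgetVertex k) where
  kind := G.gadgetKind k
  kind_symm a b := by
    classical
    have h : ∀ u v, G.Adj u v ↔ G.Adj v u := fun u v => by unfold Adj; rw [G.kind_symm u v]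
    cases a <;> cases b <;> simp only [gadgetKind]
    case branch.branch => exact if_congr eq_comm rfl rfl
    case subdiv.subdiv => exact if_congr eq_comm rfl rfl
    case rob.rob => exact if_congr (h _ _) rfl rfl
    case line.line => exact if_congr (exists_congr fun _ => and_comm) rfl rfl
    case branch.reset => exact if_congr eq_comm rfl rfl
    case reset.branch => exact if_congr eq_comm rfl rfl
    case branch.rob => exact G.kind_symm _ _
    case rob.branch => exact G.kind_symm _ _
  kind_self a := by
    cases a with
    | rob v => simp [gadgetKind, Adj, G.kind_self v]
    | line e =>
      obtain ⟨e, u, v, -, rfl⟩ := e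
      simp [gadgetKind]
    | _ => simp [gadgetKind]

end ProtGraph

/-! ### The decision problems -/

/-- An instance, common to both problems: a finite reflexive graph with protection, with
vertices numbered by `Fin n`, and a positive number `k` of cops. -/
structure CopInstance where
  n : ℕ
  graph : ProtGraph (Fin n)
  k : ℕ
  k_pos : 0 < k

/-- The alphabet in which instances are written. -/
inductive CopSymbol where
  | bit (b : Bool)
  | entry (a : EdgeKind)
  | endRow
  deriving DecidableEq

instance : Fintype CopSymbol :=
  ⟨Finset.univ.image CopSymbol.bit ∪ Finset.univ.image CopSymbol.entry ∪ {CopSymbol.endRow},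
    fun a => by cases a <;> simp⟩

namespace CopInstance

/-- An instance is written as the binary expansion of `k` followed by the adjacency matrix of the
graph, row by row, with an end marker after each row. -/
def encode (x : CopInstance) : List CopSymbol :=
  (Computability.encodeNat x.k).map CopSymbol.bit ++
    (List.finRange x.n).flatMap fun u =>
      (List.finRange x.n).map (fun v => CopSymbol.entry (x.graph.kind u v)) ++ [CopSymbol.endRow]

/-- Distinct instances are written differently. -/
theorem encode_injective : Function.Injective encode := by
  have key : ∀ {α : Type} (l : List α) (f g : α → List CopSymbol),
      (∀ a ∈ l, (f a).length = (g a).length) → l.flatMap f = l.flatMap g → ∀ a ∈ l, f a = g a := by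
    intro α l f g hl h
    induction l with
    | nil => simp
    | cons b l ih =>
      rw [List.flatMap_cons, List.flatMap_cons] at h
      obtain ⟨h1, h2⟩ := List.append_inj h (hl b (by simp))
      intro a ha
      rcases List.mem_cons.1 ha with rfl | ha
      · exact h1
      · exact ih (fun c hc => hl c (by simp [hc])) h2 a ha
  let rowsOf (x : CopInstance) : List CopSymbol := (List.finRange x.n).flatMap fun u =>
    (List.finRange x.n).map (fun v => CopSymbol.entry (x.graph.kind u v)) ++ [CopSymbol.endRow]
  let bitOf : CopSymbol → Option Bool := fun a => match a with
    | .bit b => some b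
    | _ => none
  have hbits : ∀ x : CopInstance,
      (encode x).filterMap bitOf = Computability.encodeNat x.k := by
    intro x
    have h1 : ∀ l : List Bool, (l.map CopSymbol.bit).filterMap bitOf = l := by
      intro l
      induction l with
      | nil => rfl
      | cons b l ih => simp [bitOf]
    have h2 : (rowsOf x).filterMap bitOf = [] := by
      simp [rowsOf, bitOf, List.filterMap_eq_nil_iff]
      rintro a b (⟨c, rfl⟩ | rfl) <;> rfl
    change List.filterMap bitOf (_ ++ rowsOf x) = _
    rw [List.filterMap_append, h1, h2, List.append_nil]
  have hcount : ∀ x : CopInstance, (encode x).count CopSymbol.endRow = x.n := by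
    intro x
    have h1 : ∀ l : List Bool, (l.map CopSymbol.bit).count CopSymbol.endRow = 0 := by
      intro l
      exact List.count_eq_zero.2 (by simp)
    have h2 : ∀ u : Fin x.n, ((List.finRange x.n).map
        (fun v => CopSymbol.entry (x.graph.kind u v)) ++ [CopSymbol.endRow]).count
          CopSymbol.endRow = 1 := by
      intro u
      rw [List.count_append, List.count_eq_zero.2 (by simp)]
      simp
    unfold encode
    rw [List.count_append, h1, List.count_flatMap]
    simp only [Function.comp_def, h2]
    simp
  intro x y h
  have hk : x.k = y.k := by
    have h1 := congrArg (List.filterMap bitOf) h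
    rw [hbits, hbits] at h1
    simpa using congrArg Computability.decodeNat h1
  have hn : x.n = y.n := by
    have h1 := congrArg (List.count CopSymbol.endRow) h
    rwa [hcount, hcount] at h1
  obtain ⟨n, ⟨G, hG, hG'⟩, k, hk0⟩ := x
  obtain ⟨m, ⟨H, hH, hH'⟩, l, hl0⟩ := y
  dsimp only at hk hn
  subst hk hn
  have hrows := List.append_cancel_left h
  have hGH : G = H := by
    funext u v
    have h1 := key _ _ _ (by simp) hrows u (List.mem_finRange u)
    have h2 := List.append_cancel_right h1
    have h3 := List.map_inj_left.1 h2 v (List.mem_finRange v)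
    simpa using h3
  subst hGH
  rfl

/-- The decision problem LC&RP, as the set of its yes-instances. -/
def LCRP : Set CopInstance := {x | x.graph.LazyCopsWin x.k}

/-- The decision problem C&RP, as the set of its yes-instances. -/
def CRP : Set CopInstance := {x | x.graph.CopsWin x.k}

end CopInstance

/-!
In both games the cops can win if and only if they have a starting position from which they win
against every starting position of the robber, where the positions won by the cops are defined
inductively (`CopsWinFrom`): memory does not help either side (`copsCanWin_iff`).

*The gadget.* A cop can capture on at most one vertex of the reset clique, so `k` cops can keep the
robber out of it only if each of them guards one index, which forces all of them into `G_C`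
(`Formation.exists_perm`). Whenever they are not in
formation, the robber escapes to an unguarded reset vertex. While they are in formation, at most one
of them is on a subdivision vertex, since those all guard the first index; so from `G_R` the robber
sees one cop at a time moving from `a` to `b` via the edge `ab`, which is a lazy move. He answers it
by moving half way, to the vertex of `L_R` belonging to the edge of his answer in the lazy game, and
decides whether to complete the move when he sees whether the cop does
(`exists_safe_of_represents`, `safe_step`). Conversely, the cops play a lazy winning strategy on the
branch cliques. Each lazy move takes two turns on `G'`, in which the robber is driven from `G_R` to
`L_R` and back, moving along at most one edge of `G`; anywhere else he is captured soon
(`CopsWinFrom.gadget`, `Formation.copsWinFrom`).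

*The reduction.* The graph `G'` has polynomially many vertices only if `k` is polynomially bounded,
whereas `k` is given in binary. So `G'` is used if `2 ≤ k ≤ n`, and otherwise the instance is left
as it is: for `k = 1` every move is lazy, and for `k ≥ n` the cops occupy all vertices, so that both
games on a nonempty graph are won if and only if each vertex is incident with an unprotected edge
(`lazyCopsWin_iff_of_card_le`).

*The machine.* Structured programs on several stacks are compiled to machines of Mathlib's model
`Turing.FinTM2`, one step for one step (`StackProg.computableInPolyTime`). Counters are stacks
holding unary numbers. The number `k` is converted to unary by Horner's scheme, stopped as soon as
`n` is exceeded. A vertex of `G'` is described by its kind and at most two indices less than `n`, and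
the kind of a pair of vertices of `G'` is a boolean combination of comparisons of their indices and
look-ups in the matrix of `G` (`IndexTest.kind_eq`). So the matrix of `G'` is written by nested loops
over such indices; any text produced by nested loops with such tests is computable in polynomial time
(`Generator.runs_compile`).
-/

/-! ### Winning positions -/


namespace ProtGraph

/-- `G.CopsWinFrom legal c r` says that the cops win if they stand on `c`, the robber stands on
`r`, and it is the cops' turn. -/
inductive CopsWinFrom {V : Type*} (G : ProtGraph V) {k : ℕ}
    (legal : (Fin k → V) → (Fin k → V) → Prop) : (Fin k → V) → V → Prop
  | capture {c c' : Fin k → V} {r : V} (hl : legal c c') (hc : G.Captures c c' r) :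
      CopsWinFrom G legal c r
  | move {c c' : Fin k → V} {r : V} (hl : legal c c')
      (h : ∀ r', G.Adj r r' → CopsWinFrom G legal c' r') : CopsWinFrom G legal c r

theorem adj_self {V : Type*} (G : ProtGraph V) (v : V) : G.Adj v v := G.kind_self v

theorem adj_comm {V : Type*} (G : ProtGraph V) {u v : V} : G.Adj u v ↔ G.Adj v u := by
  unfold Adj
  rw [G.kind_symm]

theorem Unprot.adj {V : Type*} {G : ProtGraph V} {u v : V} (h : G.Unprot u v) : G.Adj u v := by
  unfold Unprot at h
  simp [Adj, h]

theorem mk_mem_edgeSet {V : Type*} {G : ProtGraph V} {u v : V} :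
    s(u, v) ∈ G.edgeSet ↔ G.Adj u v := by
  constructor
  · rintro ⟨a, b, h, he⟩
    rcases Sym2.eq_iff.1 he with ⟨rfl, rfl⟩ | ⟨rfl, rfl⟩
    · exact h
    · exact G.adj_comm.1 h
  · exact fun h => ⟨u, v, h, rfl⟩

/-- From a won position the cops have a strategy, as a function of the robber's positions. -/
theorem CopsWinFrom.exists_strategy {V : Type*} {G : ProtGraph V} {k : ℕ}
    {legal : (Fin k → V) → (Fin k → V) → Prop} (hstay : ∀ c, legal c c)
    {c : Fin k → V} {r : V} (h : G.CopsWinFrom legal c r) :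
    ∃ σ : List V → Fin k → V, σ [] = c ∧ ∀ ρ : ℕ → V, ρ 0 = r →
      (∀ t, G.Adj (ρ t) (ρ (t + 1))) →
      (∀ t, legal (σ ((List.range t).map ρ)) (σ ((List.range (t + 1)).map ρ))) ∧
      ∃ t, G.Captures (σ ((List.range t).map ρ)) (σ ((List.range (t + 1)).map ρ)) (ρ t) := by
  classical
  induction h with
  | @capture c c' r hl hc =>
    refine ⟨fun l => if l = [] then c else c', by simp, fun ρ h0 _ => ⟨fun t => ?_, 0, ?_⟩⟩
    · cases t with
      | zero => simpa using hl
      | succ t => simpa using hstay c'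
    · simpa [h0] using hc
  | @move c c' r hl _ ih =>
    have ih' : ∀ r', ∃ σ : List V → Fin k → V, G.Adj r r' → σ [] = c' ∧ ∀ ρ : ℕ → V, ρ 0 = r' →
      (∀ t, G.Adj (ρ t) (ρ (t + 1))) →
      (∀ t, legal (σ ((List.range t).map ρ)) (σ ((List.range (t + 1)).map ρ))) ∧
      ∃ t, G.Captures (σ ((List.range t).map ρ)) (σ ((List.range (t + 1)).map ρ)) (ρ t) := by
      intro r'
      by_cases h : G.Adj r r'
      · obtain ⟨σ, hσ⟩ := ih r' h
        exact ⟨σ, fun _ => hσ⟩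
      · exact ⟨fun _ => c, fun h' => absurd h' h⟩
    choose τ hτ using ih'
    let σ : List V → Fin k → V := fun l => match l with
      | [] => c
      | [_] => c'
      | _ :: r' :: l => τ r' (r' :: l)
    refine ⟨σ, rfl, fun ρ h0 hρ => ?_⟩
    obtain ⟨hnil, hτ'⟩ := hτ (ρ 1) (h0 ▸ hρ 0)
    have hσ : ∀ t, σ ((List.range (t + 1)).map ρ)
        = τ (ρ 1) ((List.range t).map fun i => ρ (i + 1)) := by
      intro t
      cases t with
      | zero => simp [σ, hnil]
      | succ t => simp [σ, List.range_succ_eq_map, Function.comp_def]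
    obtain ⟨h1, t, h2⟩ := hτ' (fun i => ρ (i + 1)) rfl fun t => hρ (t + 1)
    refine ⟨fun t => ?_, t + 1, ?_⟩
    · cases t with
      | zero => rw [hσ, List.range_zero, List.map_nil, List.map_nil, hnil]; exact hl
      | succ t => rw [hσ, hσ]; exact h1 t
    · rw [hσ, hσ]; exact h2

/-- Strategies depending on the history do not help: the cops can win if and only if they have a
starting position from which they win against every starting position of the robber. -/
theorem copsCanWin_iff {V : Type*} {G : ProtGraph V} {k : ℕ}
    {legal : (Fin k → V) → (Fin k → V) → Prop} (hstay : ∀ c, legal c c) :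
    G.CopsCanWin k legal ↔ ∃ c, ∀ r, G.CopsWinFrom legal c r := by
  classical
  constructor
  · rintro ⟨σ, hσ⟩
    refine ⟨σ [], fun r₀ => ?_⟩
    by_contra hr₀
    -- The robber always moves to a vertex from which the cops do not win, if there is one.
    let next : List V → V → V := fun l r =>
      if h : ∃ r', G.Adj r r' ∧ ¬ G.CopsWinFrom legal (σ (l ++ [r])) r' then h.choose else r
    let s : ℕ → List V × V := fun t =>
      Nat.rec ([], r₀) (fun _ p => (p.1 ++ [p.2], next p.1 p.2)) t
    have hs : ∀ t, (List.range t).map (fun i => (s i).2) = (s t).1 := by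
      intro t
      induction t with
      | zero => rfl
      | succ t ih => rw [List.range_succ, List.map_append, ih]; rfl
    have hnext : ∀ l r, G.Adj r (next l r) := by
      intro l r
      by_cases h : ∃ r', G.Adj r r' ∧ ¬ G.CopsWinFrom legal (σ (l ++ [r])) r'
      · simp only [next, dif_pos h]
        exact h.choose_spec.1
      · simp only [next, dif_neg h]
        exact G.adj_self r
    obtain ⟨hlegal, t, ht⟩ := hσ (fun i => (s i).2) fun t => hnext _ _
    simp only [hs] at hlegal ht
    have hsafe : ∀ t, ¬ G.CopsWinFrom legal (σ (s t).1) (s t).2 := by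
      intro t
      induction t with
      | zero => exact hr₀
      | succ t ih =>
        have h : ∃ r', G.Adj (s t).2 r' ∧ ¬ G.CopsWinFrom legal (σ ((s t).1 ++ [(s t).2])) r' := by
          by_contra hcon
          push Not at hcon
          exact ih (.move (hlegal t) hcon)
        change ¬ G.CopsWinFrom legal (σ ((s t).1 ++ [(s t).2])) (next (s t).1 (s t).2)
        simp only [next, dif_pos h]
        exact h.choose_spec.2
    exact hsafe t (.capture (hlegal t) ht)
  · rintro ⟨c, hc⟩
    choose τ hnil hτ using fun r => (hc r).exists_strategy hstay
    let σ : List V → Fin k → V := fun l => match l with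
      | [] => c
      | r :: l => τ r (r :: l)
    refine ⟨σ, fun ρ hρ => ?_⟩
    have hσ : ∀ t, σ ((List.range t).map ρ) = τ (ρ 0) ((List.range t).map ρ) := by
      intro t
      cases t with
      | zero => simp [σ, hnil]
      | succ t => simp [σ, List.range_succ_eq_map]
    simp only [hσ]
    exact hτ (ρ 0) ρ rfl hρ

/-- A set of positions in which the robber is not captured at once and which he never has to
leave contains no position won by the cops. -/
theorem not_copsWinFrom_of_safe {V : Type*} {G : ProtGraph V} {k : ℕ}
    {legal : (Fin k → V) → (Fin k → V) → Prop} {S : (Fin k → V) → V → Prop}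
    (hS : ∀ c r, S c r → ∀ c', legal c c' →
      ¬ G.Captures c c' r ∧ ∃ r', G.Adj r r' ∧ S c' r')
    {c : Fin k → V} {r : V} (h : S c r) : ¬ G.CopsWinFrom legal c r := by
  intro hw
  induction hw with
  | capture hl hc => exact (hS _ _ h _ hl).1 hc
  | move hl _ ih =>
    obtain ⟨r', hr', h'⟩ := (hS _ _ h _ hl).2
    exact ih r' hr' h'

theorem copMove_self {V : Type*} (G : ProtGraph V) {k : ℕ} (c : Fin k → V) : G.CopMove c c :=
  fun i => G.adj_self (c i)

theorem lazyCopMove_self {V : Type*} (G : ProtGraph V) {k : ℕ} (c : Fin k → V) :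
    G.LazyCopMove c c :=
  ⟨G.copMove_self c, fun _ _ h => absurd rfl h⟩

theorem copMove_update {V : Type*} {G : ProtGraph V} {k : ℕ} {c : Fin k → V} {j : Fin k} {v : V}
    (h : G.Adj (c j) v) : G.CopMove c (Function.update c j v) := by
  intro i
  rcases eq_or_ne i j with rfl | hi
  · simpa using h
  · simpa [hi] using G.adj_self (c i)

theorem lazyCopMove_update {V : Type*} {G : ProtGraph V} {k : ℕ} {c : Fin k → V} {j : Fin k}
    {v : V} (h : G.Adj (c j) v) : G.LazyCopMove c (Function.update c j v) := by
  have key : ∀ i, c i ≠ Function.update c j v i → i = j := by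
    intro i hi
    by_contra hij
    simp [hij] at hi
  exact ⟨copMove_update h, fun i i' hi hi' => (key i hi).trans (key i' hi').symm⟩

/-- A lazy turn is the move of a single cop, possibly along a loop. -/
theorem LazyCopMove.exists_update {V : Type*} {G : ProtGraph V} {k : ℕ} (hk : 0 < k)
    {c c' : Fin k → V} (h : G.LazyCopMove c c') :
    ∃ j v, G.Adj (c j) v ∧ c' = Function.update c j v := by
  by_cases hc : c = c'
  · exact ⟨⟨0, hk⟩, c ⟨0, hk⟩, G.adj_self _, by simp [hc]⟩
  · obtain ⟨j, hj⟩ := Function.ne_iff.1 hc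
    refine ⟨j, c' j, h.1 j, ?_⟩
    funext i
    rcases eq_or_ne i j with rfl | hi
    · simp
    · rw [Function.update_of_ne hi]
      by_contra hne
      exact hi (h.2 i j (Ne.symm hne) hj)

theorem not_unprot_of_not_lazyWinFrom {V : Type*} {G : ProtGraph V} {k : ℕ} {c : Fin k → V}
    {u : V} (h : ¬ G.CopsWinFrom G.LazyCopMove c u) (j : Fin k) : ¬ G.Unprot (c j) u := by
  intro hu
  exact h (.capture (lazyCopMove_update hu.adj) ⟨j, by simp, by simpa using hu⟩)

theorem exists_of_not_copsWinFrom {V : Type*} {G : ProtGraph V} {k : ℕ}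
    {legal : (Fin k → V) → (Fin k → V) → Prop} {c c' : Fin k → V}
    {u : V} (h : ¬ G.CopsWinFrom legal c u) (hl : legal c c') :
    ∃ w, G.Adj u w ∧ ¬ G.CopsWinFrom legal c' w := by
  by_contra hcon
  push Not at hcon
  exact h (.move hl hcon)

/-! ### Guarding the reset clique -/

/-- A vertex of `G'` guards the index `i` if a cop on it captures a robber on the `i`-th vertex of
the reset clique. -/
def Guards {V : Type*} {G : ProtGraph V} {k : ℕ} (a : G.GadgetVertex k) (i : Fin k) : Prop :=
  (G.gadget k).Unprot a (.reset i)

/-- The cops are in formation if they guard the whole reset clique. -/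
def Formation {V : Type*} {G : ProtGraph V} {k : ℕ} (P : Fin k → G.GadgetVertex k) : Prop :=
  ∀ i, ∃ j, Guards (P j) i

section Guards

variable {V : Type*} {G : ProtGraph V} {k : ℕ}

@[simp] theorem guards_branch {v : V} {i j : Fin k} :
    Guards (G := G) (.branch v i) j ↔ i = j := by
  simp [Guards, Unprot, gadget, gadgetKind]

@[simp] theorem guards_subdiv {e : G.edgeSet} {j : Fin k} :
    Guards (.subdiv e) j ↔ j.val = 0 := by
  simp [Guards, Unprot, gadget, gadgetKind]

theorem Guards.cases {a : G.GadgetVertex k} {i : Fin k} (h : Guards a i) :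
    (∃ v, a = .branch v i) ∨ (∃ e, a = .subdiv e ∧ i.val = 0) := by
  cases a <;> simp_all [Guards, Unprot, gadget, gadgetKind]

theorem Guards.unique {a : G.GadgetVertex k} {i j : Fin k} (hi : Guards a i) (hj : Guards a j) :
    i = j := by
  cases a <;> simp_all [Guards, Unprot, gadget, gadgetKind, Fin.ext_iff]

/-- As there are as many cops as indices, cops in formation guard one index each. -/
theorem Formation.exists_perm {P : Fin k → G.GadgetVertex k} (h : Formation P) :
    ∃ π : Equiv.Perm (Fin k), ∀ j, Guards (P j) (π j) := by
  choose g hg using h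
  have hinj : Function.Injective g := fun i i' hi => (hg i).unique (hi ▸ hg i')
  let π : Equiv.Perm (Fin k) := Equiv.ofBijective g (Finite.injective_iff_bijective.1 hinj)
  refine ⟨π.symm, fun j => ?_⟩
  have h : Guards (P (π (π.symm j))) (π.symm j) := hg (π.symm j)
  rwa [Equiv.apply_symm_apply] at h

theorem Formation.eq_of_guards {P : Fin k → G.GadgetVertex k} (h : Formation P) {i j j' : Fin k}
    (hj : Guards (P j) i) (hj' : Guards (P j') i) : j = j' := by
  obtain ⟨π, hπ⟩ := h.exists_perm
  exact π.injective (((hπ j).unique hj).trans ((hπ j').unique hj').symm)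

theorem formation_of_perm {P : Fin k → G.GadgetVertex k} (π : Equiv.Perm (Fin k))
    (h : ∀ j, Guards (P j) (π j)) : Formation P :=
  fun i => ⟨π.symm i, by simpa using h (π.symm i)⟩

end Guards

/-! ### The robber escapes on `G'` if he escapes the lazy cops on `G` -/

/-- The cops on `P` represent lazy cops on `c`: each of them is in the branch clique of her vertex
or on a subdivision vertex next to that clique. -/
def Represents {V : Type*} {G : ProtGraph V} {k : ℕ} (P : Fin k → G.GadgetVertex k)
    (c : Fin k → V) : Prop :=
  ∀ j, (∃ i, P j = .branch (c j) i) ∨ ∃ e : G.edgeSet, P j = .subdiv e ∧ c j ∈ e.1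

/-- The positions of the game on `G'` in which the robber feels safe: he is on an unguarded reset
vertex, or on a vertex of the copy `G_R` of `G` while the cops represent a position of the lazy
game in which he is safe, or on a vertex of `L_R` that is safe and allows him to answer every turn
after which the cops are in formation. -/
def Safe {V : Type*} {G : ProtGraph V} {k : ℕ} (P : Fin k → G.GadgetVertex k) :
    G.GadgetVertex k → Prop
  | .reset i => ∀ j, ¬ Guards (P j) i
  | .rob u => ∃ c, ¬ G.CopsWinFrom G.LazyCopMove c u ∧ ∀ j, ∃ i, P j = .branch (c j) i
  | .line f => (∀ j, ¬ (G.gadget k).Unprot (P j) (.line f)) ∧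
      ∀ P', (G.gadget k).CopMove P P' → Formation P' →
        ∃ c, ∃ u ∈ f.1, ¬ G.CopsWinFrom G.LazyCopMove c u ∧ Represents P' c
  | _ => False

section Robber

variable {V : Type*} {G : ProtGraph V} {k : ℕ}

/-- Cops in formation coming from a branch clique are still in it or next to it. -/
theorem represents_step {a : G.GadgetVertex k} {v : V} {i i' : Fin k}
    (hadj : (G.gadget k).Adj (.branch v i) a) (hg : Guards a i') :
    (∃ i, a = .branch v i) ∨ ∃ e : G.edgeSet, a = .subdiv e ∧ v ∈ e.1 := by
  rcases hg.cases with ⟨w, rfl⟩ | ⟨e, rfl, -⟩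
  · left
    simp [Adj, gadget, gadgetKind] at hadj
    exact ⟨i', by rw [hadj]⟩
  · right
    simp [Adj, gadget, gadgetKind] at hadj
    exact ⟨e, rfl, hadj⟩

/-- Whenever the cops are in formation and represent a position of the lazy game in which a robber
on `u` is safe, then `u_R` or a vertex of `L_R` next to `u_R` is safe. If a cop is on a subdivision
vertex, the robber moves half way along the answer to the move that this cop is making. -/
theorem exists_safe_of_represents {P : Fin k → G.GadgetVertex k} (hP : Formation P)
    {c : Fin k → V} {u : V} (hu : ¬ G.CopsWinFrom G.LazyCopMove c u) (hc : Represents P c) :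
    Safe P (.rob u) ∨ ∃ f : G.edgeSet, u ∈ f.1 ∧ Safe P (.line f) := by
  classical
  by_cases hb : ∀ j, ∃ i, P j = .branch (c j) i
  · exact .inl ⟨c, hu, hb⟩
  right
  push Not at hb
  obtain ⟨j₀, hj₀⟩ := hb
  obtain ⟨e, he, hce⟩ : ∃ e : G.edgeSet, P j₀ = .subdiv e ∧ c j₀ ∈ e.1 :=
    (hc j₀).resolve_left fun ⟨i, hi⟩ => hj₀ i hi
  obtain ⟨b, hb⟩ := hce
  have hadj : G.Adj (c j₀) b := mk_mem_edgeSet.1 (hb ▸ e.2)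
  obtain ⟨w, huw, hw⟩ := exists_of_not_copsWinFrom hu (lazyCopMove_update hadj)
  have honly : ∀ j i, j ≠ j₀ → i.val = 0 → ¬ Guards (P j) i := by
    intro j i hj hi hg
    exact hj (hP.eq_of_guards hg (by rw [he]; simpa using hi))
  refine ⟨⟨s(u, w), mk_mem_edgeSet.2 huw⟩, by simp, ?_, ?_⟩
  · intro j
    rcases hc j with ⟨i, hi⟩ | ⟨g, hg, -⟩
    · intro hun
      have h0 : i.val = 0 := by
        rw [hi] at hun
        simpa [Unprot, gadget, gadgetKind] using hun
      rcases eq_or_ne j j₀ with rfl | hj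
      · rw [he] at hi
        cases hi
      · exact honly j i hj h0 (by rw [hi]; simp)
    · rw [hg]
      simp [Unprot, gadget, gadgetKind]
  · intro P' hmove hP'
    have hother : ∀ j, j ≠ j₀ →
        (∃ i, P' j = .branch (c j) i) ∨ ∃ e : G.edgeSet, P' j = .subdiv e ∧ c j ∈ e.1 := by
      intro j hj
      obtain ⟨π, hπ⟩ := hP'.exists_perm
      rcases hc j with ⟨i, hi⟩ | ⟨g, hg, -⟩
      · exact represents_step (hi ▸ hmove j) (hπ j)
      · refine absurd ?_ (honly j ⟨0, j.pos⟩ hj rfl)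
        rw [hg]
        simp
    by_cases hbr : ∃ i, P' j₀ = .branch b i
    · refine ⟨Function.update c j₀ b, w, by simp, hw, fun j => ?_⟩
      rcases eq_or_ne j j₀ with rfl | hj
      · left
        simpa using hbr
      · simpa [hj] using hother j hj
    · refine ⟨c, u, by simp, hu, fun j => ?_⟩
      rcases eq_or_ne j j₀ with rfl | hj
      · obtain ⟨π, hπ⟩ := hP'.exists_perm
        have hm := hmove j
        rw [he] at hm
        rcases (hπ j).cases with ⟨v, hv⟩ | ⟨g, hg, -⟩
        · left
          rw [hv] at hm
          have hve : v ∈ e.1 := by simpa [Adj, gadget, gadgetKind] using hm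
          rw [hb, Sym2.mem_iff] at hve
          rcases hve with rfl | rfl
          · exact ⟨_, hv⟩
          · exact absurd ⟨_, hv⟩ hbr
        · right
          rw [hg] at hm
          have heg : e = g := by simpa [Adj, gadget, gadgetKind] using hm
          exact ⟨g, hg, by rw [← heg, hb]; simp⟩
      · exact hother j hj

theorem exists_represents {P : Fin k → G.GadgetVertex k} (hP : Formation P) :
    ∃ c, Represents P c := by
  obtain ⟨π, hπ⟩ := hP.exists_perm
  have h : ∀ j, ∃ v, (∃ i, P j = .branch v i) ∨ ∃ e : G.edgeSet, P j = .subdiv e ∧ v ∈ e.1 := by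
    intro j
    rcases (hπ j).cases with ⟨v, hv⟩ | ⟨e, he, -⟩
    · exact ⟨v, .inl ⟨_, hv⟩⟩
    · obtain ⟨e, u, v, huv, rfl⟩ := e
      exact ⟨u, .inr ⟨_, he, by simp⟩⟩
  choose c hc using h
  exact ⟨c, hc⟩

/-- If the robber escapes the lazy cops, then on `G'` every reset vertex has a safe neighbour. -/
theorem exists_safe_of_reset (hG : ∀ c : Fin k → V, ∃ u, ¬ G.CopsWinFrom G.LazyCopMove c u)
    (i : Fin k) (P : Fin k → G.GadgetVertex k) : ∃ r, (G.gadget k).Adj (.reset i) r ∧ Safe P r := by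
  by_cases hP : Formation P
  · obtain ⟨c, hc⟩ := exists_represents hP
    obtain ⟨u, hu⟩ := hG c
    rcases exists_safe_of_represents hP hu hc with h | ⟨f, -, h⟩
    · exact ⟨_, by simp [Adj, gadget, gadgetKind], h⟩
    · exact ⟨_, by simp [Adj, gadget, gadgetKind], h⟩
  · simp only [Formation, not_forall, not_exists] at hP
    obtain ⟨i', hi'⟩ := hP
    exact ⟨.reset i', by simp [Adj, gadget, gadgetKind], hi'⟩

/-- The robber can always move from a safe position to another one. -/
theorem safe_step (hG : ∀ c : Fin k → V, ∃ u, ¬ G.CopsWinFrom G.LazyCopMove c u)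
    {P P' : Fin k → G.GadgetVertex k} {r : G.GadgetVertex k} (hr : Safe P r)
    (hmove : (G.gadget k).CopMove P P') :
    ¬ (G.gadget k).Captures P P' r ∧ ∃ r', (G.gadget k).Adj r r' ∧ Safe P' r' := by
  cases r with
  | reset i =>
    refine ⟨?_, exists_safe_of_reset hG i P'⟩
    rintro ⟨j, hj, hun⟩
    rw [hj] at hun
    exact hr j hun
  | rob u =>
    obtain ⟨c, hu, hc⟩ := hr
    constructor
    · rintro ⟨j, hj, hun⟩
      obtain ⟨i, hi⟩ := hc j
      rw [hj, hi] at hun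
      exact not_unprot_of_not_lazyWinFrom hu j hun
    · by_cases hP : Formation P'
      · have hrep : Represents P' c := by
          intro j
          obtain ⟨i, hi⟩ := hc j
          obtain ⟨π, hπ⟩ := hP.exists_perm
          exact represents_step (hi ▸ hmove j) (hπ j)
        rcases exists_safe_of_represents hP hu hrep with h | ⟨f, hf, h⟩
        · exact ⟨_, (G.gadget k).adj_self _, h⟩
        · exact ⟨_, by simpa [Adj, gadget, gadgetKind] using hf, h⟩
      · simp only [Formation, not_forall, not_exists] at hP
        obtain ⟨i', hi'⟩ := hP
        exact ⟨.reset i', by simp [Adj, gadget, gadgetKind], hi'⟩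
  | line f =>
    obtain ⟨hf, hans⟩ := hr
    constructor
    · rintro ⟨j, hj, hun⟩
      rw [hj] at hun
      exact hf j hun
    · by_cases hP : Formation P'
      · obtain ⟨c, u, huf, hu, hrep⟩ := hans P' hmove hP
        rcases exists_safe_of_represents hP hu hrep with h | ⟨g, hg, h⟩
        · exact ⟨_, by simpa [Adj, gadget, gadgetKind] using huf, h⟩
        · refine ⟨_, ?_, h⟩
          simp only [Adj, gadget, gadgetKind]
          rw [if_pos ⟨u, huf, hg⟩]
          decide
      · simp only [Formation, not_forall, not_exists] at hP
        obtain ⟨i', hi'⟩ := hP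
        exact ⟨.reset i', by simp [Adj, gadget, gadgetKind], hi'⟩
  | _ => exact hr.elim

theorem lazyCopsWin_of_gadget (hk : 0 < k) (h : (G.gadget k).CopsWin k) : G.LazyCopsWin k := by
  by_contra hlazy
  have hG : ∀ c : Fin k → V, ∃ u, ¬ G.CopsWinFrom G.LazyCopMove c u := by
    intro c
    by_contra hc
    push Not at hc
    exact hlazy ((copsCanWin_iff G.lazyCopMove_self).2 ⟨c, hc⟩)
  obtain ⟨P, hP⟩ := (copsCanWin_iff (G.gadget k).copMove_self).1 h
  obtain ⟨r, -, hr⟩ := exists_safe_of_reset hG ⟨0, hk⟩ P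
  exact not_copsWinFrom_of_safe (fun P r hr P' hl => safe_step hG hr hl) hr (hP r)

end Robber

/-! ### The cops win on `G'` if the lazy cops win on `G` -/

section Cops

variable {V : Type*} {G : ProtGraph V} {k : ℕ}

theorem copsWinFrom_of_unprot {P : Fin k → G.GadgetVertex k} {r : G.GadgetVertex k} (j : Fin k)
    (h : (G.gadget k).Unprot (P j) r) :
    (G.gadget k).CopsWinFrom (G.gadget k).CopMove P r := by
  classical
  exact .capture (copMove_update h.adj) ⟨j, by simp, by simpa using h⟩

/-- Against cops in formation the robber has to keep to the vertices of `G_R` and `L_R`: if he is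
in `G_C`, a cop moves to `ω` while another one keeps guarding the only reset vertex next to him. -/
theorem Formation.copsWinFrom (hk : 2 ≤ k) {P : Fin k → G.GadgetVertex k} (hP : Formation P)
    {r : G.GadgetVertex k} (hrob : ∀ u, r ≠ .rob u) (hline : ∀ f, r ≠ .line f) :
    (G.gadget k).CopsWinFrom (G.gadget k).CopMove P r := by
  classical
  obtain ⟨π, hπ⟩ := hP.exists_perm
  have key : ∀ i₀ : Fin k, (∀ i, (G.gadget k).Adj r (.reset i) → i = i₀) →
      (G.gadget k).CopsWinFrom (G.gadget k).CopMove P r := by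
    intro i₀ hi₀
    have : Nontrivial (Fin k) := Fin.nontrivial_iff_two_le.2 hk
    obtain ⟨i₁, hi₁⟩ := exists_ne i₀
    have homega : (G.gadget k).Adj (P (π.symm i₁)) .omega := by
      rcases (hπ (π.symm i₁)).cases with ⟨v, hv⟩ | ⟨e, he, -⟩
      · rw [hv]; simp [Adj, gadget, gadgetKind]
      · rw [he]; simp [Adj, gadget, gadgetKind]
    refine .move (copMove_update homega) fun r' hr' => ?_
    by_cases hreset : ∃ i, r' = .reset i
    · obtain ⟨i, rfl⟩ := hreset
      obtain rfl := hi₀ i hr'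
      refine copsWinFrom_of_unprot (π.symm i) ?_
      rw [Function.update_of_ne (fun h => hi₁ (π.symm.injective h).symm)]
      have := hπ (π.symm i)
      rwa [Equiv.apply_symm_apply] at this
    · refine copsWinFrom_of_unprot (π.symm i₁) ?_
      rw [Function.update_self]
      cases r' with
      | reset i => exact absurd ⟨i, rfl⟩ hreset
      | _ => rfl
  cases r with
  | reset i =>
    obtain ⟨j, hj⟩ := hP i
    exact copsWinFrom_of_unprot j hj
  | rob u => exact absurd rfl (hrob u)
  | line f => exact absurd rfl (hline f)
  | omega =>
    refine copsWinFrom_of_unprot ⟨0, by omega⟩ ?_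
    rcases (hπ ⟨0, by omega⟩).cases with ⟨v, hv⟩ | ⟨e, he, -⟩
    · rw [hv]; rfl
    · rw [he]; rfl
  | branch v i =>
    refine key i fun i' h => ?_
    have : i = i' := by simpa [Adj, gadget, gadgetKind] using h
    exact this.symm
  | subdiv e =>
    refine key ⟨0, by omega⟩ fun i' h => ?_
    have : i'.val = 0 := by simpa [Adj, gadget, gadgetKind] using h
    exact Fin.ext this

/-- If the cops stand on branch vertices with pairwise different indices, then a robber outside
`G_R` loses. -/
theorem copsWinFrom_branch (hk : 2 ≤ k) (π : Equiv.Perm (Fin k)) (c : Fin k → V)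
    {r : G.GadgetVertex k} (hrob : ∀ u, r ≠ .rob u) :
    (G.gadget k).CopsWinFrom (G.gadget k).CopMove (fun j => .branch (c j) (π j)) r := by
  by_cases hline : ∃ f, r = .line f
  · obtain ⟨f, rfl⟩ := hline
    refine copsWinFrom_of_unprot (π.symm ⟨0, by omega⟩) ?_
    simp [Unprot, gadget, gadgetKind]
  · exact (formation_of_perm π fun j => by simp).copsWinFrom hk hrob fun f hf => hline ⟨f, hf⟩

/-- The cops simulate a winning strategy of the lazy cops: to move from `a` to `b`, a cop takes the
subdivision vertex of the edge `ab`, handing her index over to the cop of index `1`. This drives the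
robber out of `G_R`, to which he has to return when the cop proceeds to the branch clique of `b`,
so that the robber, too, makes one move in `G` in the meantime. -/
theorem CopsWinFrom.gadget (hk : 2 ≤ k) {c : Fin k → V} {u : V}
    (h : G.CopsWinFrom G.LazyCopMove c u) (π : Equiv.Perm (Fin k)) :
    (G.gadget k).CopsWinFrom (G.gadget k).CopMove (fun j => .branch (c j) (π j)) (.rob u) := by
  classical
  induction h generalizing π with
  | @capture c c' u hl hc =>
    obtain ⟨j, hj, hun⟩ := hc
    exact copsWinFrom_of_unprot j (hj ▸ hun : G.Unprot (c j) u)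
  | @move c c' u hl _ ih =>
    obtain ⟨j₀, b, hb, rfl⟩ := hl.exists_update (by omega)
    let z : Fin k := ⟨0, by omega⟩
    let e : G.edgeSet := ⟨s(c j₀, b), mk_mem_edgeSet.2 hb⟩
    -- After the exchange the cop `j₀` has index `1`.
    let π' : Equiv.Perm (Fin k) := π.trans (Equiv.swap (π j₀) z)
    have hπ' : π' j₀ = z := by simp [π']
    let P' : Fin k → G.GadgetVertex k :=
      Function.update (fun j => .branch (c j) (π' j)) j₀ (.subdiv e)
    have hP' : Formation P' := by
      refine formation_of_perm π' fun j => ?_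
      rcases eq_or_ne j j₀ with rfl | hj
      · simp [P', hπ', z]
      · simp [P', hj]
    have hmove : (G.gadget k).CopMove (fun j => .branch (c j) (π j)) P' := by
      intro j
      rcases eq_or_ne j j₀ with rfl | hj
      · simp [P', e, Adj, ProtGraph.gadget, gadgetKind]
      · simp [P', hj, Adj, ProtGraph.gadget, gadgetKind]
    refine .move hmove fun r₁ hr₁ => ?_
    by_cases hrob : ∃ w, r₁ = .rob w
    · obtain ⟨w, rfl⟩ := hrob
      refine copsWinFrom_of_unprot j₀ ?_
      simp only [P', Function.update_self]
      rfl
    by_cases hline : ∃ f, r₁ = .line f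
    swap
    · exact hP'.copsWinFrom hk (fun w hw => hrob ⟨w, hw⟩) fun f hf => hline ⟨f, hf⟩
    obtain ⟨f, rfl⟩ := hline
    have huf : u ∈ f.1 := by simpa [Adj, ProtGraph.gadget, gadgetKind] using hr₁
    have hmove' : (G.gadget k).CopMove P'
        (fun j => .branch (Function.update c j₀ b j) (π' j)) := by
      intro j
      rcases eq_or_ne j j₀ with rfl | hj
      · simp [P', e, Adj, ProtGraph.gadget, gadgetKind]
      · simp [P', hj, Adj, ProtGraph.gadget, gadgetKind]
    refine .move hmove' fun r₂ hr₂ => ?_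
    by_cases hrob₂ : ∃ w, r₂ = .rob w
    · obtain ⟨w, rfl⟩ := hrob₂
      have hwf : w ∈ f.1 := by simpa [Adj, ProtGraph.gadget, gadgetKind] using hr₂
      refine ih w ?_ π'
      by_cases huw : u = w
      · exact huw ▸ G.adj_self u
      · have : f.1 = s(u, w) := (Sym2.mem_and_mem_iff huw).1 ⟨huf, hwf⟩
        exact mk_mem_edgeSet.1 (this ▸ f.2)
    · exact copsWinFrom_branch hk π' _ fun w hw => hrob₂ ⟨w, hw⟩

theorem gadget_copsWin_of_lazy (hk : 2 ≤ k) (h : G.LazyCopsWin k) : (G.gadget k).CopsWin k := by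
  obtain ⟨c, hc⟩ := (copsCanWin_iff G.lazyCopMove_self).1 h
  refine (copsCanWin_iff (G.gadget k).copMove_self).2
    ⟨fun j => .branch (c j) (Equiv.refl _ j), fun r => ?_⟩
  by_cases hrob : ∃ u, r = .rob u
  · obtain ⟨u, rfl⟩ := hrob
    exact (hc u).gadget hk _
  · exact copsWinFrom_branch hk _ c fun u hu => hrob ⟨u, hu⟩

/-- The lazy game on `G` and the game on `G'` are won by the cops for the same graphs `G`. -/
theorem lazyCopsWin_iff_gadget (hk : 2 ≤ k) : G.LazyCopsWin k ↔ (G.gadget k).CopsWin k :=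
  ⟨gadget_copsWin_of_lazy hk, lazyCopsWin_of_gadget (by omega)⟩

end Cops

/-! ### One cop, and at least as many cops as vertices -/

section FewOrMany

variable {V W : Type*} {G : ProtGraph V} {H : ProtGraph W} {k : ℕ}

theorem lazyCopsWin_one_iff : G.LazyCopsWin 1 ↔ G.CopsWin 1 := by
  have : (G.LazyCopMove : (Fin 1 → V) → (Fin 1 → V) → Prop) = G.CopMove := by
    funext c c'
    simp only [LazyCopMove, eq_iff_iff, and_iff_left_iff_imp]
    exact fun _ i j _ _ => Subsingleton.elim i j
  unfold LazyCopsWin CopsWin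
  rw [this]

theorem CopsCanWin.mono {legal legal' : (Fin k → V) → (Fin k → V) → Prop}
    (hle : ∀ c c', legal c c' → legal' c c') (h : G.CopsCanWin k legal) :
    G.CopsCanWin k legal' := by
  obtain ⟨σ, hσ⟩ := h
  exact ⟨σ, fun r hr => ⟨fun t => hle _ _ ((hσ r hr).1 t), (hσ r hr).2⟩⟩

/-- With at least as many cops as vertices, laziness does not matter: on a nonempty graph the cops
win, on their first turn, if and only if every vertex is incident with an unprotected edge. -/
theorem lazyCopsWin_iff_of_card_le [Finite V] (hk : Nat.card V ≤ k) (hk0 : 0 < k) :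
    G.LazyCopsWin k ↔ G.CopsWin k := by
  classical
  refine ⟨CopsCanWin.mono fun _ _ h => h.1, fun h => ?_⟩
  have hV : Nonempty V := by
    obtain ⟨σ, -⟩ := h
    exact ⟨σ [] ⟨0, hk0⟩⟩
  have hun : ∀ r, ∃ v, G.Unprot v r := by
    intro r
    obtain ⟨σ, hσ⟩ := h
    obtain ⟨-, t, i, hi, hcap⟩ := hσ (fun _ => r) fun _ => G.adj_self r
    exact ⟨_, hi ▸ hcap⟩
  obtain ⟨g⟩ : Nonempty (V ↪ Fin k) := by
    have := Fintype.ofFinite V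
    refine Function.Embedding.nonempty_of_card_le ?_
    simpa [Nat.card_eq_fintype_card] using hk
  refine (copsCanWin_iff G.lazyCopMove_self).2 ⟨Function.invFun g, fun r => ?_⟩
  obtain ⟨v, hv⟩ := hun r
  have hg : Function.invFun g (g v) = v := Function.leftInverse_invFun g.injective v
  exact .capture (lazyCopMove_update (j := g v) (v := r) (by rw [hg]; exact hv.adj))
    ⟨g v, by simp, by simpa [hg] using hv⟩

/-- Isomorphic graphs are equally good for the cops. -/
theorem CopsWinFrom.of_iso (φ : V ≃ W) (hφ : ∀ u v, H.kind (φ u) (φ v) = G.kind u v)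
    {c : Fin k → V} {r : V} (h : G.CopsWinFrom G.CopMove c r) :
    H.CopsWinFrom H.CopMove (φ ∘ c) (φ r) := by
  have hmv : ∀ {c c' : Fin k → V}, G.CopMove c c' → H.CopMove (φ ∘ c) (φ ∘ c') := by
    intro c c' h i
    simpa [Adj, hφ] using h i
  induction h with
  | @capture c c' r hl hc =>
    obtain ⟨i, hi, hun⟩ := hc
    refine .capture (hmv hl) ⟨i, by simp [hi], ?_⟩
    simpa [Unprot, hφ] using hun
  | @move c c' r hl _ ih =>
    refine .move (hmv hl) fun r' hr' => ?_
    obtain ⟨r', rfl⟩ := φ.surjective r'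
    exact ih r' (by simpa [Adj, hφ] using hr')

theorem Isomorphic.symm (h : G.Isomorphic H) : H.Isomorphic G := by
  obtain ⟨φ, hφ⟩ := h
  exact ⟨φ.symm, fun u v => by simpa using (hφ (φ.symm u) (φ.symm v)).symm⟩

theorem CopsWin.of_isomorphic (h : G.Isomorphic H) (hG : G.CopsWin k) : H.CopsWin k := by
  obtain ⟨φ, hφ⟩ := h
  obtain ⟨c, hc⟩ := (copsCanWin_iff G.copMove_self).1 hG
  refine (copsCanWin_iff H.copMove_self).2 ⟨φ ∘ c, fun r => ?_⟩
  simpa using (hc (φ.symm r)).of_iso φ hφ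

theorem Isomorphic.copsWin_iff (h : G.Isomorphic H) : G.CopsWin k ↔ H.CopsWin k :=
  ⟨.of_isomorphic h, .of_isomorphic h.symm⟩

end FewOrMany

end ProtGraph

/-! ### Structured programs on stacks -/

/-- Structured programs acting on stacks indexed by `K` with symbols in `Γ` and on one register,
which contains a symbol or nothing. -/
inductive StackProg (K Γ : Type) where
  /-- Push a symbol depending on the register. -/
  | push (k : K) (f : Option Γ → Γ)
  /-- Move the top of a stack to the register, which becomes empty if the stack is empty. -/
  | pop (k : K)
  /-- Empty the register. -/
  | clear
  /-- Run `p`, then `q`. -/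
  | seq (p q : StackProg K Γ)
  /-- Run `p` or `q`, depending on the register. -/
  | ite (c : Option Γ → Bool) (p q : StackProg K Γ)
  /-- Pop from a stack and run the body, until the stack is found empty. -/
  | loop (k : K) (p : StackProg K Γ)

namespace StackProg

variable {K Γ : Type}

/-- Run one program after the other. -/
infixr:60 " ;; " => StackProg.seq

/-- `Exec p r S r' S' t`: started with register `r` and stacks `S`, the program `p` stops after `t`
steps with register `r'` and stacks `S'`. -/
inductive Exec [DecidableEq K] : StackProg K Γ → Option Γ → (K → List Γ) →
    Option Γ → (K → List Γ) → ℕ → Prop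
  | push {k f r S} : Exec (push k f) r S r (Function.update S k (f r :: S k)) 1
  | pop {k r S} : Exec (pop k) r S (S k).head? (Function.update S k (S k).tail) 1
  | clear {r S} : Exec clear r S none S 1
  | seq {p q r S r' S' r'' S'' t t'} (hp : Exec p r S r' S' t) (hq : Exec q r' S' r'' S'' t') :
      Exec (seq p q) r S r'' S'' (t + t')
  | ite_true {c p q r S r' S' t} (hc : c r = true) (h : Exec p r S r' S' t) :
      Exec (ite c p q) r S r' S' (1 + t)
  | ite_false {c p q r S r' S' t} (hc : c r = false) (h : Exec q r S r' S' t) :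
      Exec (ite c p q) r S r' S' (1 + t)
  | loop_nil {k p r S} (hk : S k = []) : Exec (loop k p) r S none S 1
  | loop_cons {k p r S a l r' S' r'' S'' t t'} (hk : S k = a :: l)
      (hp : Exec p (some a) (Function.update S k l) r' S' t)
      (hloop : Exec (loop k p) r' S' r'' S'' t') : Exec (loop k p) r S r'' S'' (1 + (t + t'))

/-! ### Compilation to Turing machines -/

/-- The labels of the machine running a program: one for each node of its syntax tree that costs
a step. -/
def Label : StackProg K Γ → Type
  | push _ _ => Unit
  | pop _ => Unit
  | clear => Unit
  | seq p q => Label p ⊕ Label q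
  | ite _ p q => Option (Label p ⊕ Label q)
  | loop _ p => Option (Label p)

/-- A program has finitely many labels. -/
@[reducible]
def Label.fintype : (p : StackProg K Γ) → Fintype p.Label
  | push _ _ => inferInstanceAs (Fintype Unit)
  | pop _ => inferInstanceAs (Fintype Unit)
  | clear => inferInstanceAs (Fintype Unit)
  | seq p q =>
    letI := Label.fintype p
    letI := Label.fintype q
    inferInstanceAs (Fintype (p.Label ⊕ q.Label))
  | ite _ p q =>
    letI := Label.fintype p
    letI := Label.fintype q
    inferInstanceAs (Fintype (Option (p.Label ⊕ q.Label)))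
  | loop _ p =>
    letI := Label.fintype p
    inferInstanceAs (Fintype (Option p.Label))

/-- The label at which a program starts. -/
def start : (p : StackProg K Γ) → p.Label
  | push _ _ => ()
  | pop _ => ()
  | clear => ()
  | seq p _ => Sum.inl (start p)
  | ite _ _ _ => none
  | loop _ _ => none

/-- The statements at the labels of a program, if these labels are embedded into those of a larger
machine by `emb` and the machine is to continue at `ex` when the program stops. -/
def code {Λ : Type} : (p : StackProg K Γ) → (p.Label → Λ) → Λ → p.Label →
    Turing.TM2.Stmt (fun _ : K => Γ) Λ (Option Γ)
  | push k f, _, ex, _ => .push k f (.goto fun _ => ex)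
  | pop k, _, ex, _ => .pop k (fun _ a => a) (.goto fun _ => ex)
  | clear, _, ex, _ => .load (fun _ => none) (.goto fun _ => ex)
  | seq p q, emb, _, Sum.inl l => code p (fun l => emb (Sum.inl l)) (emb (Sum.inr (start q))) l
  | seq _ q, emb, ex, Sum.inr l => code q (fun l => emb (Sum.inr l)) ex l
  | ite c p q, emb, _, none =>
    .branch c (.goto fun _ => emb (some (Sum.inl (start p))))
      (.goto fun _ => emb (some (Sum.inr (start q))))
  | ite _ p _, emb, ex, some (Sum.inl l) => code p (fun l => emb (some (Sum.inl l))) ex l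
  | ite _ _ q, emb, ex, some (Sum.inr l) => code q (fun l => emb (some (Sum.inr l))) ex l
  | loop k p, emb, ex, none =>
    .pop k (fun _ a => a) (.branch Option.isSome (.goto fun _ => emb (some (start p)))
      (.goto fun _ => ex))
  | loop _ p, emb, _, some l => code p (fun l => emb (some l)) (emb none) l

/-- A machine containing the code of a program simulates it step by step. -/
theorem Exec.iterate_step [DecidableEq K] {p : StackProg K Γ} {r : Option Γ} {S : K → List Γ}
    {r' : Option Γ} {S' : K → List Γ} {t : ℕ} (h : Exec p r S r' S' t) {Λ : Type}
    (M : Λ → Turing.TM2.Stmt (fun _ : K => Γ) Λ (Option Γ)) (emb : p.Label → Λ) (ex : Λ)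
    (hM : ∀ l, M (emb l) = code p emb ex l) :
    (flip bind (Turing.TM2.step M))^[t] (some ⟨some (emb (start p)), r, S⟩) =
      some ⟨some ex, r', S'⟩ := by
  induction h generalizing ex with
  | push =>
    have := hM ()
    simp [flip, start, this, code]
  | pop =>
    have := hM ()
    simp [flip, start, this, code]
  | clear =>
    have := hM ()
    simp [flip, start, this, code]
  | @seq p q _ _ _ _ _ _ t t' _ _ ihp ihq =>
    rw [Nat.add_comm, Function.iterate_add_apply]
    have h1 := ihp (fun l => emb (Sum.inl l)) (emb (Sum.inr (start q))) fun l => hM (Sum.inl l)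
    have h2 := ihq (fun l => emb (Sum.inr l)) ex fun l => hM (Sum.inr l)
    exact (congrArg _ h1).trans h2
  | @ite_true c p q r S r' S' t hc _ ih =>
    rw [Nat.add_comm, Function.iterate_succ_apply]
    rw [← ih (fun l => emb (some (Sum.inl l))) ex fun l => hM (some (Sum.inl l))]
    have := hM none
    simp [flip, start, this, code, hc]
  | @ite_false c p q r S r' S' t hc _ ih =>
    rw [Nat.add_comm, Function.iterate_succ_apply]
    rw [← ih (fun l => emb (some (Sum.inr l))) ex fun l => hM (some (Sum.inr l))]
    have := hM none
    simp [flip, start, this, code, hc]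
  | @loop_nil k p r S hk =>
    have := hM none
    have hS : Function.update S k [] = S := by rw [← hk, Function.update_eq_self]
    simp [flip, start, this, code, hk, hS]
  | @loop_cons k p r S a l r' S' r'' S'' t t' hk _ _ ihp ihloop =>
    rw [Nat.add_comm, Function.iterate_succ_apply, Nat.add_comm, Function.iterate_add_apply]
    have h1 := ihp (fun l => emb (some l)) (emb none) fun l => hM (some l)
    have h2 := ihloop emb ex hM
    have h3 : flip bind (Turing.TM2.step M) (some ⟨some (emb (start (loop k p))), r, S⟩) =
        some ⟨some (emb (some (start p))), some a, Function.update S k l⟩ := by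
      have := hM none
      simp [flip, start, this, code, hk]
    rw [h3]
    exact (congrArg _ h1).trans h2

/-- The machine that runs a program and halts. -/
def toFinTM2 [DecidableEq K] [Fintype K] [Fintype Γ] (p : StackProg K Γ) (k₀ k₁ : K) :
    Turing.FinTM2 :=
  letI := Label.fintype p
  { K := K
    k₀ := k₀
    k₁ := k₁
    Γ := fun _ => Γ
    Λ := Option p.Label
    main := some p.start
    σ := Option Γ
    initialState := none
    Γk₀Fin := inferInstanceAs (Fintype Γ)
    m := fun l => match l with
      | none => .halt
      | some l => code p some none l }

/-- A program computes a function in polynomial time if, within polynomially many steps, it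
replaces the encoding of each argument by that of the value, with the register and all other stacks
empty before and after. -/
theorem computableInPolyTime [DecidableEq K] [Fintype K] [Fintype Γ] {α β : Type}
    (p : StackProg K Γ) (k₀ k₁ : K) (ea : α → List Γ) (eb : β → List Γ) (f : α → β)
    (T : Polynomial ℕ)
    (h : ∀ a, ∃ t ≤ T.eval (ea a).length,
      Exec p none (Function.update (fun _ => []) k₀ (ea a)) none
        (Function.update (fun _ => []) k₁ (eb (f a))) t) :
    Nonempty (Turing.TM2ComputableInPolyTime ea eb f) := by
  refine ⟨⟨⟨p.toFinTM2 k₀ k₁, Equiv.refl Γ, Equiv.refl Γ⟩, T + 1, fun a => ?_⟩⟩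
  choose t ht hex using h
  refine ⟨⟨t a + 1, ?_⟩, by simpa using ht a⟩
  have hupd : ∀ (k₀ : K) (l : List Γ),
      (fun k => if _ : k = k₀ then l.map id else []) = Function.update (fun _ => []) k₀ l := by
    intro k₀ l
    funext k
    by_cases hk : k = k₀
    · subst hk
      simp
    · simp [hk]
  have hinit : Turing.initList (p.toFinTM2 k₀ k₁) (List.map (Equiv.refl Γ).invFun (ea a)) =
      ⟨some (some p.start), none, Function.update (fun _ => []) k₀ (ea a)⟩ :=
    congrArg (Turing.TM2.Cfg.mk (some (some p.start)) none) (hupd k₀ (ea a))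
  have hhalt : Turing.haltList (p.toFinTM2 k₀ k₁) (List.map (Equiv.refl Γ).invFun (eb (f a))) =
      ⟨none, none, Function.update (fun _ => []) k₁ (eb (f a))⟩ :=
    congrArg (Turing.TM2.Cfg.mk none none) (hupd k₁ (eb (f a)))
  have hrun := (hex a).iterate_step (p.toFinTM2 k₀ k₁).m some none fun l => rfl
  rw [Option.map_some, Function.iterate_succ_apply']
  erw [hinit, hhalt, hrun]
  rfl

/-! ### Running times -/

variable [DecidableEq K]

/-- Started with register `r` and stacks `S`, the program stops with stacks `S'` after at most `t`
steps. -/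
def RunsFrom (p : StackProg K Γ) (r : Option Γ) (S S' : K → List Γ) (t : ℕ) : Prop :=
  ∃ r', ∃ t' ≤ t, Exec p r S r' S' t'

/-- Started with stacks `S`, whatever the register, the program stops with stacks `S'` after at most
`t` steps. -/
def Runs (p : StackProg K Γ) (S S' : K → List Γ) (t : ℕ) : Prop := ∀ r, RunsFrom p r S S' t

variable {p q : StackProg K Γ} {r : Option Γ} {S S' S'' : K → List Γ} {t t' : ℕ}

theorem RunsFrom.mono (h : RunsFrom p r S S' t) (ht : t ≤ t') : RunsFrom p r S S' t' := by
  obtain ⟨r', s, hs, h⟩ := h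
  exact ⟨r', s, hs.trans ht, h⟩

theorem Runs.mono (h : Runs p S S' t) (ht : t ≤ t') : Runs p S S' t' := fun r => (h r).mono ht

theorem RunsFrom.seq (hp : RunsFrom p r S S' t) (hq : Runs q S' S'' t') :
    RunsFrom (p ;; q) r S S'' (t + t') := by
  obtain ⟨r', s, hs, h⟩ := hp
  obtain ⟨r'', s', hs', h'⟩ := hq r'
  exact ⟨r'', s + s', Nat.add_le_add hs hs', h.seq h'⟩

theorem Runs.seq (hp : Runs p S S' t) (hq : Runs q S' S'' t') :
    Runs (p ;; q) S S'' (t + t') := fun r => (hp r).seq hq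

theorem RunsFrom.push {k : K} {f : Option Γ → Γ} :
    RunsFrom (push k f) r S (Function.update S k (f r :: S k)) 1 := ⟨_, _, le_rfl, .push⟩

theorem Runs.push {k : K} {a : Γ} :
    Runs (push k fun _ => a) S (Function.update S k (a :: S k)) 1 := fun _ => .push

theorem Runs.clear : Runs (clear : StackProg K Γ) S S 1 := fun _ => ⟨_, _, le_rfl, .clear⟩

theorem RunsFrom.push_seq {k : K} {f : Option Γ → Γ}
    (h : RunsFrom q r (Function.update S k (f r :: S k)) S' t) :
    RunsFrom (StackProg.push k f ;; q) r S S' (1 + t) := by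
  obtain ⟨r', s, hs, h⟩ := h
  exact ⟨r', 1 + s, by omega, Exec.push.seq h⟩

theorem RunsFrom.pop_seq {k : K}
    (h : RunsFrom q (S k).head? (Function.update S k (S k).tail) S' t) :
    RunsFrom (StackProg.pop k ;; q) r S S' (1 + t) := by
  obtain ⟨r', s, hs, h⟩ := h
  exact ⟨r', 1 + s, by omega, Exec.pop.seq h⟩

theorem RunsFrom.ite {c : Option Γ → Bool}
    (h : if c r then RunsFrom p r S S' t else RunsFrom q r S S' t) :
    RunsFrom (StackProg.ite c p q) r S S' (1 + t) := by
  by_cases hc : c r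
  · rw [if_pos hc] at h
    obtain ⟨r', s, hs, h⟩ := h
    exact ⟨r', 1 + s, by omega, .ite_true hc h⟩
  · rw [if_neg hc] at h
    obtain ⟨r', s, hs, h⟩ := h
    exact ⟨r', 1 + s, by omega, .ite_false (by simpa using hc) h⟩

end StackProg

/-! ### The memory of the machine -/

/-- The counters of the machine: the vertices of the output graph are described by two indices each,
and a matrix entry by two vertices, which makes four loop variables; further there are the number
`n` of vertices of the input, the number `k` of cops, the constant `1` and two auxiliary
counters. -/
inductive Counter where
  | row | row' | col | col' | n | k | one | aux | aux'
  deriving DecidableEq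

instance : Fintype Counter :=
  ⟨{.row, .row', .col, .col', .n, .k, .one, .aux, .aux'}, fun a => by cases a <;> decide⟩

/-- The stacks of the machine. A counter is a stack, too, with its value written in unary. -/
inductive StackName where
  | inp | out | bits | bits' | mat | mat'
  | cnt (x : Counter)
  deriving DecidableEq

instance : Fintype StackName :=
  ⟨{.inp, .out, .bits, .bits', .mat, .mat'} ∪ Finset.univ.image .cnt,
    fun a => by cases a <;> simp⟩

/-- The programs of the machine. -/
abbrev CopProg := StackProg StackName CopSymbol

/-- The contents of all stacks, with counters as natural numbers. -/
structure Memory where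
  inp : List CopSymbol
  out : List CopSymbol
  bits : List CopSymbol
  bits' : List CopSymbol
  mat : List CopSymbol
  mat' : List CopSymbol
  cnt : Counter → ℕ

namespace Memory

/-- The stacks storing given contents. -/
def store (m : Memory) : StackName → List CopSymbol
  | .inp => m.inp
  | .out => m.out
  | .bits => m.bits
  | .bits' => m.bits'
  | .mat => m.mat
  | .mat' => m.mat'
  | .cnt x => List.replicate (m.cnt x) .endRow

variable (m : Memory) (l : List CopSymbol)

@[simp] theorem store_inp : m.store .inp = m.inp := rfl
@[simp] theorem store_out : m.store .out = m.out := rfl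
@[simp] theorem store_bits : m.store .bits = m.bits := rfl
@[simp] theorem store_bits' : m.store .bits' = m.bits' := rfl
@[simp] theorem store_mat : m.store .mat = m.mat := rfl
@[simp] theorem store_mat' : m.store .mat' = m.mat' := rfl
@[simp] theorem store_cnt (x : Counter) :
    m.store (.cnt x) = List.replicate (m.cnt x) .endRow := rfl

@[simp] theorem update_inp : Function.update m.store .inp l = { m with inp := l }.store := by
  funext s; cases s <;> rfl
@[simp] theorem update_out : Function.update m.store .out l = { m with out := l }.store := by
  funext s; cases s <;> rfl
@[simp] theorem update_bits : Function.update m.store .bits l = { m with bits := l }.store := by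
  funext s; cases s <;> rfl
@[simp] theorem update_bits' :
    Function.update m.store .bits' l = { m with bits' := l }.store := by
  funext s; cases s <;> rfl
@[simp] theorem update_mat : Function.update m.store .mat l = { m with mat := l }.store := by
  funext s; cases s <;> rfl
@[simp] theorem update_mat' : Function.update m.store .mat' l = { m with mat' := l }.store := by
  funext s; cases s <;> rfl
@[simp] theorem update_cnt (x : Counter) (i : ℕ) :
    Function.update m.store (.cnt x) (List.replicate i .endRow) =
      { m with cnt := Function.update m.cnt x i }.store := by
  funext s
  cases s with
  | cnt y =>
    by_cases h : y = x
    · subst h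
      simp
    · simp [h]
  | _ => rfl

end Memory

namespace StackProg

/-! ### Elementary programs -/

/-- Move a stack onto another one, which reverses it. -/
def pour (a b : StackName) : CopProg := loop a (push b fun r => r.getD .endRow)

/-- Empty a stack. -/
def empty (a : StackName) : CopProg := loop a clear

/-- Increment a counter. -/
def inc (x : Counter) : CopProg := push (.cnt x) fun _ => .endRow

theorem Runs.pour {a b : StackName} (hab : a ≠ b) (S : StackName → List CopSymbol) :
    Runs (pour a b) S (Function.update (Function.update S a []) b ((S a).reverse ++ S b))
      ((S a).length * 2 + 1) := by
  generalize hl : S a = l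
  induction l generalizing S with
  | nil =>
    have h : Function.update (Function.update S a []) b ([].reverse ++ S b) = S := by
      rw [← hl, Function.update_eq_self, hl, List.reverse_nil, List.nil_append,
        Function.update_eq_self]
    rw [h]
    exact fun r => ⟨none, 1, by simp, .loop_nil hl⟩
  | cons s l ih =>
    intro r
    let S₁ := Function.update (Function.update S a l) b (s :: S b)
    have h1 : Exec (StackProg.push b fun r => r.getD .endRow) (some s) (Function.update S a l)
        (some s) S₁ 1 := by
      have := Exec.push (k := b) (f := fun r => r.getD .endRow) (r := some s)
        (S := Function.update S a l)
      simpa [hab.symm, S₁] using this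
    obtain ⟨r', t, ht, h2⟩ := ih S₁ (by simp [S₁, hab]) (some s)
    have h3 : Function.update (Function.update S₁ a []) b (l.reverse ++ S₁ b) =
        Function.update (Function.update S a []) b ((s :: l).reverse ++ S b) := by
      funext c
      by_cases hb : c = b
      · subst hb
        simp [S₁]
      · by_cases ha : c = a
        · subst ha
          simp [hb]
        · simp [S₁, ha, hb]
    rw [h3] at h2
    exact ⟨r', _, by simp only [List.length_cons]; omega, .loop_cons hl h1 h2⟩

theorem Runs.empty {a : StackName} (S : StackName → List CopSymbol) :
    Runs (empty a) S (Function.update S a []) ((S a).length * 2 + 1) := by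
  generalize hl : S a = l
  induction l generalizing S with
  | nil =>
    have h : Function.update S a [] = S := by rw [← hl, Function.update_eq_self]
    rw [h]
    exact fun r => ⟨none, 1, by simp, .loop_nil hl⟩
  | cons s l ih =>
    intro r
    obtain ⟨r', t, ht, h2⟩ := ih (Function.update S a l) (by simp) none
    rw [Function.update_idem] at h2
    exact ⟨r', _, by simp only [List.length_cons]; omega, .loop_cons hl .clear h2⟩

theorem Runs.empty_cnt (x : Counter) (m : Memory) :
    Runs (StackProg.empty (.cnt x)) m.store { m with cnt := Function.update m.cnt x 0 }.store
      (m.cnt x * 2 + 1) := by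
  have h := Runs.empty (a := .cnt x) m.store
  rw [← List.replicate_zero, Memory.update_cnt] at h
  simpa using h

theorem Runs.pour_cnt {x y : Counter} (hxy : x ≠ y) (m : Memory) :
    Runs (StackProg.pour (.cnt x) (.cnt y)) m.store
      { m with cnt := Function.update (Function.update m.cnt x 0) y (m.cnt x + m.cnt y) }.store
      (m.cnt x * 2 + 1) := by
  have h := Runs.pour (a := .cnt x) (b := .cnt y) (by simpa using hxy) m.store
  have h0 : ([] : List CopSymbol) = List.replicate 0 .endRow := rfl
  rw [h0, Memory.update_cnt] at h
  simpa [← List.replicate_add] using h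

theorem RunsFrom.inc (x : Counter) (m : Memory) {r : Option CopSymbol} :
    RunsFrom (StackProg.inc x) r m.store
      { m with cnt := Function.update m.cnt x (m.cnt x + 1) }.store 1 := by
  rw [← Memory.update_cnt]
  exact .push

theorem RunsFrom.inc_seq {x : Counter} {m : Memory} {r : Option CopSymbol} {q : CopProg}
    {S : StackName → List CopSymbol} {t : ℕ}
    (h : RunsFrom q r { m with cnt := Function.update m.cnt x (m.cnt x + 1) }.store S t) :
    RunsFrom (StackProg.inc x ;; q) r m.store S (1 + t) := by
  rw [← Memory.update_cnt] at h
  exact .push_seq h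

/-- Popping a counter decrements it if it is not zero. -/
theorem RunsFrom.dec_seq {x : Counter} {m : Memory} {r : Option CopSymbol} {q : CopProg}
    {S : StackName → List CopSymbol} {t : ℕ}
    (h : RunsFrom q (if m.cnt x = 0 then none else some .endRow)
      { m with cnt := Function.update m.cnt x (m.cnt x - 1) }.store S t) :
    RunsFrom (StackProg.pop (.cnt x) ;; q) r m.store S (1 + t) := by
  refine .pop_seq ?_
  rw [Memory.store_cnt, List.tail_replicate, Memory.update_cnt, List.head?_replicate]
  exact h

/-- A loop controlled by a counter `x`, with the memory given as a function of that counter. -/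
theorem Runs.loop_cnt {x : Counter} {p : CopProg} {t : ℕ} (F : ℕ → Memory)
    (hF : ∀ i, (F i).cnt x = i) (N : ℕ)
    (h : ∀ i < N, RunsFrom p (some .endRow)
      { F (i + 1) with cnt := Function.update (F (i + 1)).cnt x i }.store (F i).store t) :
    Runs (StackProg.loop (.cnt x) p) (F N).store (F 0).store (N * (t + 1) + 1) := by
  induction N with
  | zero => exact fun r => ⟨none, 1, by simp, .loop_nil (by simp [hF])⟩
  | succ N ih =>
    intro r
    obtain ⟨r', s, hs, hex⟩ := h N (Nat.lt_succ_self N)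
    obtain ⟨r'', s', hs', hex'⟩ := ih (fun i hi => h i (hi.trans (Nat.lt_succ_self N))) r'
    rw [← Memory.update_cnt] at hex
    refine ⟨r'', 1 + (s + s'), ?_, .loop_cons ?_ hex hex'⟩
    · rw [Nat.add_mul]
      omega
    · simp [hF, List.replicate_succ]

/-- Copy the counter `n` to the counter `x`. -/
def copyN (x : Counter) : CopProg :=
  loop (.cnt .n) (inc .aux ;; inc x) ;; pour (.cnt .aux) (.cnt .n)

theorem Runs.copyN {x : Counter} (hn : x ≠ .n) (ha : x ≠ .aux) {m : Memory} (hx : m.cnt x = 0)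
    (haux : m.cnt .aux = 0) :
    Runs (StackProg.copyN x) m.store
      { m with cnt := Function.update m.cnt x (m.cnt .n) }.store (m.cnt .n * 5 + 2) := by
  let N := m.cnt .n
  let F : ℕ → Memory := fun i => { m with cnt := Function.update (Function.update
    (Function.update m.cnt .n i) .aux (N - i)) x (N - i) }
  have h1 := Runs.loop_cnt (x := .n) (p := StackProg.inc .aux ;; StackProg.inc x) (t := 2) F
    (fun i => by simp [F, hn.symm]) N (by
      intro i hi
      refine RunsFrom.inc_seq (t := 1) ?_
      convert! RunsFrom.inc x _ using 3
      funext z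
      simp only [F, Function.update_apply]
      split_ifs <;> simp_all <;> omega)
  have h2 := Runs.pour_cnt (x := .aux) (y := .n) (by simp) (F 0)
  have hN : F N = m := by
    simp only [F]
    congr 1
    funext z
    simp only [Function.update_apply]
    split_ifs <;> simp_all [N]
  rw [hN] at h1
  have h3 := h1.seq h2
  refine Runs.mono (t := N * (2 + 1) + 1 + ((F 0).cnt .aux * 2 + 1)) ?_ ?_
  · convert! h3 using 3
    funext z
    simp only [F, Function.update_apply]
    split_ifs <;> simp_all [N]
  · simp [F, ha.symm]
    omega

end StackProg

open StackProg

/-! ### Tests on counters and matrix entries -/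

/-- Conditions on the counters and the matrix. -/
inductive IndexTest where
  | tt
  /-- The counter `x` is less than the counter `y`. -/
  | lt (x y : Counter)
  /-- The entry of the matrix in row `x` and column `y` is `a`. -/
  | entry (x y : Counter) (a : EdgeKind)
  | not (c : IndexTest)
  | and (c d : IndexTest)
  | or (c d : IndexTest)

namespace IndexTest

/-- The truth value of a condition, where the matrix is written row by row without markers. -/
def eval (mat : List CopSymbol) (env : Counter → ℕ) : IndexTest → Bool
  | tt => true
  | lt x y => decide (env x < env y)
  | entry x y a => decide (mat[env x * env .n + env y]? = some (.entry a))
  | not c => !c.eval mat env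
  | and c d => c.eval mat env && d.eval mat env
  | or c d => c.eval mat env || d.eval mat env

/-- Conditions that the machine can test: auxiliary counters do not occur in them, the numbers
compared are different counters, and `n` is not used as a row number. -/
def WF : IndexTest → Bool
  | tt => true
  | lt x y => x ≠ y ∧ x ≠ .aux ∧ x ≠ .aux' ∧ y ≠ .aux ∧ y ≠ .aux'
  | entry x y _ => x ≠ .n ∧ x ≠ .aux ∧ x ≠ .aux' ∧ y ≠ .aux ∧ y ≠ .aux'
  | not c => c.WF
  | and c d => c.WF && d.WF
  | or c d => c.WF && d.WF

/-- Move the top of the matrix, if there is one, to the auxiliary stack. -/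
def skipEntry : CopProg :=
  pop .mat ;; ite Option.isSome (push .mat' fun r => r.getD .endRow) clear

/-- Skip as many rows as `x` indicates. -/
def skipRows (x : Counter) : CopProg :=
  loop (.cnt x) (inc .aux ;; loop (.cnt .n) (inc .aux' ;; skipEntry) ;;
    pour (.cnt .aux') (.cnt .n)) ;; pour (.cnt .aux) (.cnt x)

/-- Skip as many entries as `y` indicates. -/
def skipEntries (y : Counter) : CopProg :=
  loop (.cnt y) (inc .aux ;; skipEntry) ;; pour (.cnt .aux) (.cnt y)

/-- Decrement a copy of `x` and `y` simultaneously, until `x` vanishes: what is left of `y` is the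
truncated difference. -/
def subtract (x y : Counter) : CopProg :=
  loop (.cnt x) (inc .aux ;; pop (.cnt y) ;; ite Option.isSome (inc .aux') clear)

/-- Undo a subtraction. -/
def restore (x y : Counter) : CopProg := pour (.cnt .aux) (.cnt x) ;; pour (.cnt .aux') (.cnt y)

/-- The program that tests a condition and continues with `A` if it holds and with `B` if not. -/
def compile : IndexTest → CopProg → CopProg → CopProg
  | tt, A, _ => A
  | lt x y, A, B => subtract x y ;; pop (.cnt y) ;;
      ite Option.isSome (inc y ;; restore x y ;; A) (restore x y ;; B)
  | entry x y a, A, B => skipRows x ;; skipEntries y ;; pop .mat ;;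
      ite (fun r => r = some (.entry a))
        (push .mat (fun r => r.getD .endRow) ;; pour .mat' .mat ;; A)
        (ite Option.isSome (push .mat (fun r => r.getD .endRow) ;; pour .mat' .mat ;; B)
          (pour .mat' .mat ;; B))
  | not c, A, B => c.compile B A
  | and c d, A, B => c.compile (d.compile A B) B
  | or c d, A, B => c.compile A (d.compile A B)

end IndexTest

/-- The auxiliary stacks are empty, and `B` bounds the counters and the size of the matrix. -/
structure Memory.Tidy (m : Memory) (B : ℕ) : Prop where
  aux : m.cnt .aux = 0
  aux' : m.cnt .aux' = 0
  mat' : m.mat' = []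
  cnt_le : ∀ x, m.cnt x ≤ B
  mat_le : m.mat.length ≤ B

namespace IndexTest

/-- The memory after a subtraction. -/
def difference (m : Memory) (x y : Counter) : Memory where
  __ := m
  cnt := Function.update (Function.update (Function.update (Function.update m.cnt x 0) y
    (m.cnt y - m.cnt x)) .aux (m.cnt x)) .aux' (min (m.cnt y) (m.cnt x))

theorem runs_subtract {x y : Counter} (h : (lt x y).WF) {m : Memory} (haux : m.cnt .aux = 0)
    (haux' : m.cnt .aux' = 0) :
    Runs (subtract x y) m.store (difference m x y).store (m.cnt x * 5 + 1) := by
  simp only [WF, ne_eq, decide_eq_true_eq] at h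
  obtain ⟨hxy, hx, hx', hy, hy'⟩ := h
  let F : ℕ → Memory := fun i =>
    { m with
      cnt := Function.update (Function.update (Function.update (Function.update m.cnt x i) y
        (m.cnt y - (m.cnt x - i))) .aux (m.cnt x - i)) .aux' (min (m.cnt y) (m.cnt x - i)) }
  have key := Runs.loop_cnt (x := x)
    (p := inc .aux ;; pop (.cnt y) ;; ite Option.isSome (inc .aux') clear) (t := 4) F
    (fun i => by simp [F, hxy, hx, hx']) (m.cnt x) (by
      intro i hi
      refine RunsFrom.inc_seq (t := 3) (RunsFrom.dec_seq (t := 2) (RunsFrom.ite (t := 1) ?_))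
      by_cases h0 : m.cnt y - (m.cnt x - (i + 1)) = 0
      · rw [if_neg (by simp [F, hy, hy', Ne.symm hxy, h0])]
        convert! (Runs.clear : Runs (clear : CopProg) (F i).store (F i).store 1) _ using 3
        funext z
        simp only [F, Function.update_apply]
        split_ifs <;> simp_all <;> omega
      · rw [if_pos (by simp [F, hy, hy', Ne.symm hxy, h0])]
        convert! RunsFrom.inc .aux' _ using 3
        funext z
        simp only [F, Function.update_apply]
        split_ifs <;> simp_all <;> omega)
  have hN : F (m.cnt x) = m := by
    simp only [F]
    congr 1
    funext z
    simp only [Function.update_apply]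
    split_ifs <;> simp_all
  rw [hN] at key
  convert! key using 3

theorem runs_restore {x y : Counter} (h : (lt x y).WF) {m : Memory}
    (haux : m.cnt .aux = 0) (haux' : m.cnt .aux' = 0) :
    Runs (restore x y) (difference m x y).store m.store (m.cnt x * 4 + 2) := by
  simp only [WF, ne_eq, decide_eq_true_eq] at h
  obtain ⟨hxy, hx, hx', hy, hy'⟩ := h
  have h1 := Runs.pour_cnt (x := .aux) (y := x) (Ne.symm hx) (difference m x y)
  have h2 := Runs.pour_cnt (x := .aux') (y := y) (Ne.symm hy') { difference m x y with
    cnt := Function.update (Function.update (difference m x y).cnt .aux 0) x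
      ((difference m x y).cnt .aux + (difference m x y).cnt x) }
  convert! (h1.seq h2).mono (t' := m.cnt x * 4 + 2) ?_ using 2
  · unfold difference
    cases m
    congr 1
    funext z
    simp only [Function.update_apply]
    split_ifs <;> simp_all
    omega
  · simp only [difference, Function.update_apply]
    simp [Ne.symm hx']
    omega

end IndexTest

open StackProg

/-- The memory after the first `i` entries of the matrix have been skipped. -/
def Memory.seek (m : Memory) (i : ℕ) : Memory where
  __ := m
  mat := m.mat.drop i
  mat' := (m.mat.take i).reverse

namespace IndexTest

theorem runs_rewind {m : Memory} (hm : m.mat' = []) (i : ℕ) :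
    Runs (pour .mat' .mat) (m.seek i).store m.store (m.mat.length * 2 + 1) := by
  have h := Runs.pour (a := .mat') (b := .mat) (by simp) (m.seek i).store
  have e : { m.seek i with mat' := [], mat := m.mat } = m := by
    cases m
    simp_all [Memory.seek]
  simp only [Memory.update_mat', Memory.update_mat, Memory.store_mat, Memory.store_mat',
    Memory.seek, List.reverse_reverse, List.take_append_drop] at h e ⊢
  rw [e] at h
  refine h.mono ?_
  simp only [List.length_reverse, List.length_take]
  omega

theorem runs_skipEntry (m : Memory) (i : ℕ) (r : Option CopSymbol) :
    RunsFrom skipEntry r (m.seek i).store (m.seek (i + 1)).store 3 := by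
  refine RunsFrom.pop_seq (t := 2) (RunsFrom.ite (t := 1) ?_)
  by_cases hi : i < m.mat.length
  · have hd : m.mat.drop i = m.mat[i] :: m.mat.drop (i + 1) := List.drop_eq_getElem_cons hi
    have hs : (m.seek i).store .mat = m.mat[i] :: m.mat.drop (i + 1) := hd
    have ht : (m.mat.take (i + 1)).reverse = m.mat[i] :: (m.mat.take i).reverse := by
      rw [List.take_succ_eq_append_getElem hi, List.reverse_append]
      rfl
    rw [hs, if_pos (by rfl)]
    convert! RunsFrom.push using 1
    rw [Memory.update_mat, List.tail_cons, Memory.update_mat']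
    simp [Memory.seek, ht, List.getElem?_eq_getElem hi]
  · have hs : (m.seek i).store .mat = [] := by
      simp only [Memory.store_mat, Memory.seek, List.drop_eq_nil_iff]
      omega
    rw [hs, if_neg (by simp), List.tail_nil, Memory.update_mat]
    convert! (Runs.clear : Runs (clear : CopProg) (m.seek (i + 1)).store
      (m.seek (i + 1)).store 1) _ using 2
    simp only [Memory.seek, Memory.mk.injEq, true_and, and_true]
    constructor
    · rw [List.drop_eq_nil_of_le (by omega)]
    · rw [List.take_of_length_le (by omega), List.take_of_length_le (by omega)]

theorem runs_skipRow {m : Memory} (haux' : m.cnt .aux' = 0) (i : ℕ) :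
    Runs (loop (.cnt .n) (inc .aux' ;; skipEntry) ;; pour (.cnt .aux') (.cnt .n))
      (m.seek i).store (m.seek (i + m.cnt .n)).store (m.cnt .n * 7 + 2) := by
  let F : ℕ → Memory := fun j => Memory.seek
    { m with
      cnt := Function.update (Function.update m.cnt .n j) .aux' (m.cnt .n - j) }
    (i + (m.cnt .n - j))
  have h1 := Runs.loop_cnt (x := .n) (p := inc .aux' ;; skipEntry) (t := 4) F
    (fun j => by simp [F, Memory.seek]) (m.cnt .n) (by
      intro j hj
      refine RunsFrom.inc_seq (t := 3) ?_
      convert! runs_skipEntry { m with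
        cnt := Function.update (Function.update m.cnt .n j) .aux' (m.cnt .n - j) }
        (i + (m.cnt .n - (j + 1))) _ using 2
      · simp only [F, Memory.seek, Memory.mk.injEq, true_and]
        funext z
        simp only [Function.update_apply]
        split_ifs <;> simp_all
        omega
      · simp only [F]
        congr 1
        omega)
  have h2 := Runs.pour_cnt (x := .aux') (y := .n) (by simp) (F 0)
  have e1 : F (m.cnt .n) = m.seek i := by
    simp only [F, Memory.seek, Nat.sub_self, Nat.add_zero, Memory.mk.injEq, true_and]
    funext z
    simp only [Function.update_apply]
    split_ifs <;> simp_all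
  rw [e1] at h1
  convert! (h1.seq h2).mono (t' := m.cnt .n * 7 + 2) ?_ using 2
  · simp only [F, Memory.seek, Nat.sub_zero, Memory.mk.injEq, true_and]
    funext z
    simp only [Function.update_apply]
    split_ifs <;> simp_all
  · simp [F, Memory.seek]
    omega

theorem runs_skipRows {x : Counter} (hn : x ≠ .n) (hx : x ≠ .aux) (hx' : x ≠ .aux') {m : Memory}
    (haux : m.cnt .aux = 0) (haux' : m.cnt .aux' = 0) :
    Runs (skipRows x) (m.seek 0).store (m.seek (m.cnt x * m.cnt .n)).store
      (m.cnt x * (m.cnt .n * 7 + 6) + 2) := by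
  let C : ℕ → Memory := fun j =>
    { m with
      cnt := Function.update (Function.update m.cnt x j) .aux (m.cnt x - j) }
  let F : ℕ → Memory := fun j => (C j).seek ((m.cnt x - j) * m.cnt .n)
  have h1 := Runs.loop_cnt (x := x) (p := inc .aux ;; loop (.cnt .n) (inc .aux' ;; skipEntry) ;;
    pour (.cnt .aux') (.cnt .n)) (t := m.cnt .n * 7 + 3) F
    (fun j => by simp [F, C, Memory.seek, hx]) (m.cnt x) (by
      intro j hj
      have hCn : (C j).cnt .n = m.cnt .n := by simp [C, Ne.symm hn]
      have h := runs_skipRow (m := C j) (by simp [C, Ne.symm hx', haux'])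
        ((m.cnt x - (j + 1)) * m.cnt .n) (some .endRow)
      rw [hCn] at h
      refine (RunsFrom.inc_seq (t := m.cnt .n * 7 + 2) ?_).mono (by omega)
      convert! h using 2
      · simp only [F, C, Memory.seek, Memory.mk.injEq, true_and]
        funext z
        simp only [Function.update_apply]
        split_ifs <;> simp_all
        omega
      · simp only [F]
        congr 1
        rw [show m.cnt x - j = m.cnt x - (j + 1) + 1 by omega, Nat.add_mul, Nat.one_mul])
  have h2 := Runs.pour_cnt (x := .aux) (y := x) (Ne.symm hx) (F 0)
  have e1 : F (m.cnt x) = m.seek 0 := by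
    simp only [F, C, Memory.seek, Nat.sub_self, Nat.zero_mul, Memory.mk.injEq, true_and]
    funext z
    simp only [Function.update_apply]
    split_ifs <;> simp_all
  rw [e1] at h1
  convert! (h1.seq h2).mono (t' := m.cnt x * (m.cnt .n * 7 + 6) + 2) ?_ using 2
  · simp only [F, C, Memory.seek, Nat.sub_zero, Memory.mk.injEq, true_and]
    funext z
    simp only [Function.update_apply]
    split_ifs <;> simp_all
  · have : (F 0).cnt .aux = m.cnt x := by simp [F, C, Memory.seek]
    rw [this]
    apply le_of_eq
    ring

theorem runs_skipEntries {y : Counter} (hy : y ≠ .aux) {m : Memory}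
    (haux : m.cnt .aux = 0) (i : ℕ) :
    Runs (skipEntries y) (m.seek i).store (m.seek (i + m.cnt y)).store (m.cnt y * 7 + 2) := by
  let C : ℕ → Memory := fun j =>
    { m with
      cnt := Function.update (Function.update m.cnt y j) .aux (m.cnt y - j) }
  let F : ℕ → Memory := fun j => (C j).seek (i + (m.cnt y - j))
  have h1 := Runs.loop_cnt (x := y) (p := inc .aux ;; skipEntry) (t := 4) F
    (fun j => by simp [F, C, Memory.seek, hy]) (m.cnt y) (by
      intro j hj
      refine RunsFrom.inc_seq (t := 3) ?_
      convert! runs_skipEntry (C j) (i + (m.cnt y - (j + 1))) _ using 2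
      · simp only [F, C, Memory.seek, Memory.mk.injEq, true_and]
        funext z
        simp only [Function.update_apply]
        split_ifs <;> simp_all
        omega
      · simp only [F]
        congr 1
        omega)
  have h2 := Runs.pour_cnt (x := .aux) (y := y) (Ne.symm hy) (F 0)
  have e1 : F (m.cnt y) = m.seek i := by
    simp only [F, C, Memory.seek, Nat.sub_self, Nat.add_zero, Memory.mk.injEq, true_and]
    funext z
    simp only [Function.update_apply]
    split_ifs <;> simp_all
  rw [e1] at h1
  convert! (h1.seq h2).mono (t' := m.cnt y * 7 + 2) ?_ using 2
  · simp only [F, C, Memory.seek, Nat.sub_zero, Memory.mk.injEq, true_and]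
    funext z
    simp only [Function.update_apply]
    split_ifs <;> simp_all
  · simp [F, C, Memory.seek]
    omega

/-- Testing a condition takes polynomial time. -/
theorem runs_compile {c : IndexTest} (hc : c.WF) :
    ∃ P : Polynomial ℕ, ∀ (A A' : CopProg) (m : Memory) (S : StackName → List CopSymbol) (B t : ℕ),
      m.Tidy B → Runs (if c.eval m.mat m.cnt then A else A') m.store S t →
      Runs (c.compile A A') m.store S (P.eval B + t) := by
  induction c with
  | tt => exact ⟨0, fun A A' m S B t _ h => by simpa [eval, compile] using h⟩
  | lt x y =>
    refine ⟨9 * Polynomial.X + 6, fun A A' m S B t hm h r => ?_⟩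
    have hr := runs_restore hc hm.aux hm.aux'
    have hwf := hc
    simp only [WF, ne_eq, decide_eq_true_eq] at hwf
    obtain ⟨hxy, hx, hx', hy, hy'⟩ := hwf
    have hcy : (difference m x y).cnt y = m.cnt y - m.cnt x := by
      simp [difference, hy, hy']
    refine (RunsFrom.seq (runs_subtract hc hm.aux hm.aux' r) (t' := m.cnt x * 4 + 5 + t)
      fun r => ?_).mono ?_
    · refine (RunsFrom.dec_seq (t := m.cnt x * 4 + 4 + t) (RunsFrom.ite
        (t := m.cnt x * 4 + 3 + t) ?_ |>.mono (by omega))).mono (by omega)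
      by_cases hlt : m.cnt x < m.cnt y
      · have hpos : (difference m x y).cnt y ≠ 0 := by rw [hcy]; omega
        simp only [hpos, Option.isSome_some, if_true, if_false]
        refine (RunsFrom.inc_seq (t := m.cnt x * 4 + 2 + t) ?_).mono (by omega)
        have e : { difference m x y with
            cnt := Function.update (Function.update (difference m x y).cnt y
              ((difference m x y).cnt y - 1)) y ((difference m x y).cnt y - 1 + 1) } =
            difference m x y := by
          have : (difference m x y).cnt y - 1 + 1 = (difference m x y).cnt y := by omega
          rw [this, Function.update_idem, Function.update_eq_self]
        simp only [Function.update_self]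
        rw [e]
        have h' : Runs A m.store S t := by simpa [eval, hlt] using h
        exact (hr _).seq h' |>.mono (by omega)
      · have hzero : (difference m x y).cnt y = 0 := by rw [hcy]; omega
        simp only [hzero, Option.isSome_none, Bool.false_eq_true, if_true, if_false]
        have e : { difference m x y with
            cnt := Function.update (difference m x y).cnt y (0 - 1) } = difference m x y := by
          rw [Nat.zero_sub, ← hzero, Function.update_eq_self]
        rw [e]
        have h' : Runs A' m.store S t := by simpa [eval, hlt] using h
        exact (hr _).seq h' |>.mono (by omega)
    · have := hm.cnt_le x
      simp only [Polynomial.eval_add, Polynomial.eval_mul, Polynomial.eval_ofNat,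
        Polynomial.eval_X]
      omega
  | entry x y a =>
    refine ⟨7 * Polynomial.X ^ 2 + 15 * Polynomial.X + 20, fun A A' m S B t hm h r => ?_⟩
    simp only [WF, ne_eq, decide_eq_true_eq] at hc
    obtain ⟨hn, hx, hx', hy, hy'⟩ := hc
    have h0 : m.seek 0 = m := by
      have := hm.mat'
      cases m
      simp_all [Memory.seek]
    have h1 := runs_skipRows hn hx hx' hm.aux hm.aux'
    rw [h0] at h1
    have h2 := runs_skipEntries hy hm.aux (m.cnt x * m.cnt .n)
    set i := m.cnt x * m.cnt .n + m.cnt y with hi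
    have hrew := runs_rewind hm.mat' i
    have hback : ∀ s, m.mat[i]? = some s →
        Function.update (Function.update (m.seek i).store .mat ((m.seek i).store .mat).tail) .mat
          (s :: (m.seek i).mat.tail) = (m.seek i).store := by
      intro s hs
      obtain ⟨hlt, hs⟩ := List.getElem?_eq_some_iff.1 hs
      have hd : m.mat.drop i = s :: m.mat.drop (i + 1) := by
        rw [← hs]
        exact List.drop_eq_getElem_cons hlt
      have hd' : (m.seek i).store .mat = s :: m.mat.drop (i + 1) := hd
      have hd'' : (m.seek i).mat = s :: m.mat.drop (i + 1) := hd
      rw [Function.update_idem, hd'', List.tail_cons, ← hd', Function.update_eq_self]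
    have hhead : ((m.seek i).store .mat).head? = m.mat[i]? := by
      simp [Memory.seek, List.head?_drop]
    have key : Runs (pop .mat ;;
      ite (fun r => r = some (.entry a))
        (push .mat (fun r => r.getD .endRow) ;; pour .mat' .mat ;; A)
        (ite Option.isSome (push .mat (fun r => r.getD .endRow) ;; pour .mat' .mat ;; A')
          (pour .mat' .mat ;; A'))) (m.seek i).store S (m.mat.length * 2 + 5 + t) := by
      intro r
      refine (RunsFrom.pop_seq (t := m.mat.length * 2 + 4 + t) ((RunsFrom.ite
        (t := m.mat.length * 2 + 3 + t) ?_).mono (by omega))).mono (by omega)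
      rw [hhead]
      cases hs : m.mat[i]? with
      | none =>
        have h' : Runs A' m.store S t := by simpa [eval, ← hi, hs] using h
        have hnil : (m.seek i).store .mat = [] := by
          rw [← List.head?_eq_none_iff, hhead, hs]
        rw [if_neg (by simp)]
        refine (RunsFrom.ite (t := m.mat.length * 2 + 2 + t) ?_).mono (by omega)
        rw [if_neg (by simp), hnil, List.tail_nil, ← hnil, Function.update_eq_self]
        exact (hrew none).seq h' |>.mono (by omega)
      | some s =>
        have hb := hback s hs
        by_cases hsa : s = .entry a
        · rw [if_pos (by simp [hsa])]
          have h' : Runs A m.store S t := by simpa [eval, ← hi, hs, hsa] using h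
          refine (RunsFrom.push_seq (t := m.mat.length * 2 + 1 + t) ?_).mono (by omega)
          simp only [Function.update_self, Option.getD_some]
          rw [Memory.store_mat] at hb ⊢
          rw [hb]
          exact (hrew _).seq h' |>.mono (by omega)
        · rw [if_neg (by simp [hsa])]
          have h' : Runs A' m.store S t := by simpa [eval, ← hi, hs, hsa] using h
          refine (RunsFrom.ite (t := m.mat.length * 2 + 2 + t) ?_).mono (by omega)
          rw [if_pos (by simp)]
          refine (RunsFrom.push_seq (t := m.mat.length * 2 + 1 + t) ?_).mono (by omega)
          simp only [Function.update_self, Option.getD_some]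
          rw [Memory.store_mat] at hb ⊢
          rw [hb]
          exact (hrew _).seq h' |>.mono (by omega)
    refine ((h1 r).seq (h2.seq key)).mono ?_
    have hxB := hm.cnt_le x
    have hyB := hm.cnt_le y
    have hnB := hm.cnt_le .n
    have hmB := hm.mat_le
    have hxn : m.cnt x * m.cnt .n ≤ B * B := Nat.mul_le_mul hxB hnB
    simp only [Polynomial.eval_add, Polynomial.eval_mul, Polynomial.eval_ofNat,
      Polynomial.eval_X, Polynomial.eval_pow]
    nlinarith
  | not c ih =>
    obtain ⟨P, hP⟩ := ih hc
    refine ⟨P, fun A A' m S B t hm h => hP _ _ m S B t hm ?_⟩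
    by_cases he : c.eval m.mat m.cnt <;> simpa [eval, he] using h
  | and c d ihc ihd =>
    simp only [WF, Bool.and_eq_true] at hc
    obtain ⟨P, hP⟩ := ihc hc.1
    obtain ⟨Q, hQ⟩ := ihd hc.2
    refine ⟨P + Q, fun A A' m S B t hm h => ?_⟩
    rw [Polynomial.eval_add, Nat.add_assoc]
    refine hP _ _ m S B _ hm ?_
    by_cases he : c.eval m.mat m.cnt
    · rw [if_pos he]
      refine hQ _ _ m S B _ hm ?_
      simpa [eval, he] using h
    · rw [if_neg he]
      have h' : Runs A' m.store S t := by simpa [eval, he] using h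
      exact h'.mono (by omega)
  | or c d ihc ihd =>
    simp only [WF, Bool.and_eq_true] at hc
    obtain ⟨P, hP⟩ := ihc hc.1
    obtain ⟨Q, hQ⟩ := ihd hc.2
    refine ⟨P + Q, fun A A' m S B t hm h => ?_⟩
    rw [Polynomial.eval_add, Nat.add_assoc]
    refine hP _ _ m S B _ hm ?_
    by_cases he : c.eval m.mat m.cnt
    · rw [if_pos he]
      have h' : Runs A m.store S t := by simpa [eval, he] using h
      exact h'.mono (by omega)
    · rw [if_neg he]
      refine hQ _ _ m S B _ hm ?_
      simpa [eval, he] using h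

end IndexTest

/-! ### Generating text by nested loops -/

/-- Programs producing text by nested loops over the numbers less than `n`. -/
inductive Generator where
  | nop
  | emit (a : CopSymbol)
  | seq (g h : Generator)
  /-- Run `g` for all values `x < n`, in increasing order. -/
  | loop (x : Counter) (g : Generator)
  | cond (c : IndexTest) (g h : Generator)

namespace Generator

/-- The text produced. -/
def text (mat : List CopSymbol) : (Counter → ℕ) → Generator → List CopSymbol
  | _, nop => []
  | _, emit a => [a]
  | env, seq g h => g.text mat env ++ h.text mat env
  | env, loop x g => (List.range (env .n)).flatMap fun i => g.text mat (Function.update env x i)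
  | env, cond c g h => if c.eval mat env then g.text mat env else h.text mat env

/-- The machine can run a generator if the tests are admissible and no loop uses a counter which is
already in use. -/
def WF : List Counter → Generator → Bool
  | _, nop => true
  | _, emit _ => true
  | used, seq g h => g.WF used && h.WF used
  | used, loop x g => x ∉ used && g.WF (x :: used)
  | used, cond c g h => c.WF && g.WF used && h.WF used

/-- The program running a generator. As the text is written on a stack, its last symbol has to be
pushed first; so loops count downwards and sequences are run backwards. -/
def compile : Generator → CopProg
  | nop => clear
  | emit a => push .out fun _ => a
  | seq g h => h.compile ;; g.compile
  | loop x g => copyN x ;; StackProg.loop (.cnt x) g.compile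
  | cond c g h => c.compile g.compile h.compile

theorem runs_compile {used : List Counter} (hn : .n ∈ used) (haux : .aux ∈ used)
    (haux' : .aux' ∈ used) {g : Generator} (hg : g.WF used) :
    ∃ P : Polynomial ℕ, ∀ (m : Memory) (B : ℕ), m.Tidy B → (∀ x, x ∉ used → m.cnt x = 0) →
      Runs g.compile m.store { m with out := g.text m.mat m.cnt ++ m.out }.store (P.eval B) := by
  induction g generalizing used with
  | nop => exact ⟨1, fun m B _ _ => by simpa [text, compile] using Runs.clear⟩
  | emit a =>
    refine ⟨1, fun m B _ _ => ?_⟩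
    have := Runs.push (k := StackName.out) (a := a) (S := m.store)
    simpa [text, compile] using this
  | seq g h ihg ihh =>
    simp only [WF, Bool.and_eq_true] at hg
    obtain ⟨P, hP⟩ := ihg hn haux haux' hg.1
    obtain ⟨Q, hQ⟩ := ihh hn haux haux' hg.2
    refine ⟨Q + P, fun m B hm h0 => ?_⟩
    rw [Polynomial.eval_add]
    refine (hQ m B hm h0).seq ?_
    have := hP { m with out := h.text m.mat m.cnt ++ m.out } B
      ⟨hm.aux, hm.aux', hm.mat', hm.cnt_le, hm.mat_le⟩ h0
    simpa [text] using this
  | cond c g h ihg ihh =>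
    simp only [WF, Bool.and_eq_true] at hg
    obtain ⟨Pc, hPc⟩ := IndexTest.runs_compile hg.1.1
    obtain ⟨P, hP⟩ := ihg hn haux haux' hg.1.2
    obtain ⟨Q, hQ⟩ := ihh hn haux haux' hg.2
    refine ⟨Pc + (P + Q), fun m B hm h0 => ?_⟩
    rw [Polynomial.eval_add]
    refine hPc _ _ m _ B _ hm ?_
    rw [Polynomial.eval_add]
    by_cases he : c.eval m.mat m.cnt
    · simp only [text, he, if_true]
      exact (hP m B hm h0).mono (by omega)
    · simp only [text, he]
      exact (hQ m B hm h0).mono (by omega)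
  | loop x g ih =>
    simp only [WF, Bool.and_eq_true, decide_eq_true_eq] at hg
    have hxn : x ≠ .n := fun h => hg.1 (h ▸ hn)
    have hxa : x ≠ .aux := fun h => hg.1 (h ▸ haux)
    have hxa' : x ≠ .aux' := fun h => hg.1 (h ▸ haux')
    obtain ⟨P, hP⟩ := ih (List.mem_cons_of_mem x hn) (List.mem_cons_of_mem x haux)
      (List.mem_cons_of_mem x haux') hg.2
    refine ⟨Polynomial.X * (P + 6) + 3, fun m B hm h0 => ?_⟩
    have hx0 := h0 x hg.1
    have hNB := hm.cnt_le .n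
    have h1 := Runs.copyN hxn hxa hx0 hm.aux
    let N := m.cnt .n
    let o : ℕ → List CopSymbol := fun i => g.text m.mat (Function.update m.cnt x i)
    let F : ℕ → Memory := fun i =>
      { m with
        cnt := Function.update m.cnt x i
        out := ((List.range N).drop i).flatMap o ++ m.out }
    have h2 := Runs.loop_cnt (x := x) (p := g.compile) (t := P.eval B) F
      (fun i => by simp [F]) N (by
        intro i hi
        have h := hP { F (i + 1) with cnt := Function.update (F (i + 1)).cnt x i } B (by
          refine ⟨?_, ?_, hm.mat', fun z => ?_, hm.mat_le⟩
          · simp [F, Ne.symm hxa, hm.aux]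
          · simp [F, Ne.symm hxa', hm.aux']
          · rcases eq_or_ne z x with rfl | hz
            · simp only [Function.update_self]
              exact (hi.trans_le hNB).le
            · simpa [F, hz] using hm.cnt_le z) (by
          intro z hz
          simp only [List.mem_cons, not_or] at hz
          simpa [F, hz.1] using h0 z hz.2) (some .endRow)
        convert! h using 2
        have hd : (List.range N).drop i = i :: (List.range N).drop (i + 1) := by
          rw [List.drop_eq_getElem_cons (by simpa using hi), List.getElem_range]
        simp [F, hd, o])
    have e1 : F N = { m with cnt := Function.update m.cnt x N } := by
      simp only [F]
      rw [List.drop_eq_nil_of_le (by simp), List.flatMap_nil, List.nil_append]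
    have e2 : F 0 = { m with out := text m.mat m.cnt (.loop x g) ++ m.out } := by
      simp only [F, text, List.drop_zero]
      rw [← hx0, Function.update_eq_self]
    rw [e1, e2] at h2
    refine (h1.seq h2).mono ?_
    have : N * (P.eval B + 6) ≤ B * (P.eval B + 6) := Nat.mul_le_mul_right _ hNB
    simp only [Polynomial.eval_add, Polynomial.eval_mul, Polynomial.eval_ofNat,
      Polynomial.eval_X]
    simp only [N] at *
    nlinarith

end Generator

open ProtGraph

/-! ### Listing the vertices of `G'` -/

/-- The kinds of vertices of `G'`. -/
inductive VertexTag where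
  | branch | subdiv | rob | line | reset | omega

/-- All kinds of vertices of `G'`, in the order in which the vertices are listed. -/
def VertexTag.all : List VertexTag := [.branch, .subdiv, .rob, .line, .reset, .omega]

/-- What describes a vertex of `G'`: its kind and two indices. For vertices `v_C^i` these are `v` and
`i`, for edges their smaller and their larger endpoint; an index that is not needed is `0`. -/
abbrev VertexCode (n : ℕ) := VertexTag × Fin n × Fin n

/-- All combinations of kinds and indices. -/
def VertexCode.all (n : ℕ) : List (VertexCode n) :=
  VertexTag.all.flatMap fun t => (List.finRange n).flatMap fun i =>
    (List.finRange n).map fun j => (t, i, j)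

theorem VertexCode.mem_all {n : ℕ} (c : VertexCode n) : c ∈ VertexCode.all n := by
  obtain ⟨t, i, j⟩ := c
  cases t <;> simp [VertexCode.all, VertexTag.all]

theorem VertexCode.nodup_all (n : ℕ) : (VertexCode.all n).Nodup := by
  unfold VertexCode.all
  have hprod : ∀ t : VertexTag, (List.finRange n).flatMap (fun i =>
      (List.finRange n).map fun j => (t, i, j)) =
      ((List.finRange n) ×ˢ (List.finRange n)).map fun p => (t, p) := by
    intro t
    simp [SProd.sprod, List.product, List.map_flatMap, Function.comp_def]
  simp only [hprod]
  have : VertexTag.all.flatMap (fun t =>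
      ((List.finRange n) ×ˢ (List.finRange n)).map fun p => (t, p)) =
      VertexTag.all ×ˢ ((List.finRange n) ×ˢ (List.finRange n)) := rfl
  rw [this]
  exact (by simp [VertexTag.all] : VertexTag.all.Nodup).product
    ((List.nodup_finRange n).product (List.nodup_finRange n))

theorem Sym2.eq_mk_inf_sup {α : Type*} [LinearOrder α] (e : Sym2 α) : e = s(e.inf, e.sup) :=
  Sym2.inf_eq_inf_and_sup_eq_sup.1 ⟨by simp [e.inf_le_sup], by simp [e.inf_le_sup]⟩

namespace ProtGraph

variable {n k : ℕ} {G : ProtGraph (Fin n)}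

/-- The description of a vertex of `G'`. -/
def GadgetVertex.code (h0 : 0 < n) (hk : k ≤ n) : G.GadgetVertex k → VertexCode n
  | .branch v i => (.branch, v, i.castLE hk)
  | .subdiv e => (.subdiv, e.1.inf, e.1.sup)
  | .rob v => (.rob, v, ⟨0, h0⟩)
  | .line e => (.line, e.1.inf, e.1.sup)
  | .reset i => (.reset, i.castLE hk, ⟨0, h0⟩)
  | .omega => (.omega, ⟨0, h0⟩, ⟨0, h0⟩)

theorem GadgetVertex.code_injective (h0 : 0 < n) (hk : k ≤ n) :
    Function.Injective (GadgetVertex.code (G := G) h0 hk) := by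
  intro a b h
  cases a <;> cases b <;> simp_all [GadgetVertex.code]
  · exact Subtype.ext (Sym2.inf_eq_inf_and_sup_eq_sup.1 h)
  · exact Subtype.ext (Sym2.inf_eq_inf_and_sup_eq_sup.1 h)

/-- The vertices of `G'`, in the order in which the machine produces them. -/
noncomputable def gadgetVertices (G : ProtGraph (Fin n)) (h0 : 0 < n) (hk : k ≤ n) :
    List (G.GadgetVertex k) :=
  (VertexCode.all n).filterMap (Function.partialInv (GadgetVertex.code (G := G) h0 hk))

theorem mem_gadgetVertices (h0 : 0 < n) (hk : k ≤ n) (a : G.GadgetVertex k) :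
    a ∈ G.gadgetVertices h0 hk :=
  List.mem_filterMap.2 ⟨_, VertexCode.mem_all _,
    ((GadgetVertex.code_injective h0 hk).isPartialInv _ _).2 rfl⟩

theorem nodup_gadgetVertices (h0 : 0 < n) (hk : k ≤ n) : (G.gadgetVertices (k := k) h0 hk).Nodup :=
  List.Nodup.filterMap (Function.injective_of_isPartialInv_right
    (GadgetVertex.code_injective h0 hk).isPartialInv) (VertexCode.nodup_all n)

/-- The graph `G'` with its vertices numbered. -/
noncomputable def numberedGadget (G : ProtGraph (Fin n)) (h0 : 0 < n) (hk : k ≤ n) :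
    ProtGraph (Fin (G.gadgetVertices (k := k) h0 hk).length) where
  kind i j := (G.gadget k).kind ((G.gadgetVertices h0 hk).get i) ((G.gadgetVertices h0 hk).get j)
  kind_symm _ _ := (G.gadget k).kind_symm _ _
  kind_self _ := (G.gadget k).kind_self _

theorem numberedGadget_isomorphic (h0 : 0 < n) (hk : k ≤ n) :
    (G.numberedGadget (k := k) h0 hk).Isomorphic (G.gadget k) :=
  ⟨Equiv.ofBijective _ (List.Nodup.getBijectionOfForallMemList _ (nodup_gadgetVertices h0 hk)
    (mem_gadgetVertices h0 hk)).2, fun _ _ => rfl⟩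

end ProtGraph

open Classical in
/-- The reduction: the graph is replaced by `G'` if `2 ≤ k ≤ n`. If `k = 1` or `k > n`, then laziness
does not matter anyhow, and the instance is kept. -/
noncomputable def gadgetReduction (x : CopInstance) : CopInstance :=
  if h : 2 ≤ x.k ∧ x.k ≤ x.n then
    ⟨_, x.graph.numberedGadget (k := x.k) (by omega) h.2, x.k, x.k_pos⟩
  else x

theorem gadgetReduction_k (x : CopInstance) : (gadgetReduction x).k = x.k := by
  unfold gadgetReduction
  split_ifs <;> rfl

theorem gadgetReduction_of_le {x : CopInstance} (h : 2 ≤ x.k) (h' : x.k ≤ x.n) :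
    gadgetReduction x =
      ⟨_, x.graph.numberedGadget (k := x.k) (by omega) h', x.k, x.k_pos⟩ :=
  dif_pos ⟨h, h'⟩

theorem gadgetReduction_of_not {x : CopInstance} (h : ¬ (2 ≤ x.k ∧ x.k ≤ x.n)) :
    gadgetReduction x = x := dif_neg h

theorem gadgetReduction_isomorphic {x : CopInstance} (h : 2 ≤ x.k) (h' : x.k ≤ x.n) :
    (gadgetReduction x).graph.Isomorphic (x.graph.gadget x.k) := by
  rw [gadgetReduction_of_le h h']
  exact numberedGadget_isomorphic _ h'

theorem mem_LCRP_iff_gadgetReduction (x : CopInstance) :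
    x ∈ CopInstance.LCRP ↔ gadgetReduction x ∈ CopInstance.CRP := by
  change x.graph.LazyCopsWin x.k ↔ (gadgetReduction x).graph.CopsWin (gadgetReduction x).k
  by_cases h : 2 ≤ x.k ∧ x.k ≤ x.n
  · rw [gadgetReduction_k, (gadgetReduction_isomorphic h.1 h.2).copsWin_iff]
    exact lazyCopsWin_iff_gadget h.1
  · rw [gadgetReduction_of_not h]
    obtain ⟨n, G, k, hk0⟩ := x
    dsimp only at h ⊢
    by_cases hk : k = 1
    · subst hk
      exact lazyCopsWin_one_iff
    · exact lazyCopsWin_iff_of_card_le (by simp only [Nat.card_fin]; omega) hk0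

/-! ### The generators of the output -/

namespace IndexTest

section

variable {mat : List CopSymbol} {env : Counter → ℕ} {c d : IndexTest} {x y : Counter}

@[simp] theorem eval_tt : tt.eval mat env = true := rfl
@[simp] theorem eval_lt : (lt x y).eval mat env = decide (env x < env y) := rfl
@[simp] theorem eval_not : (not c).eval mat env = !c.eval mat env := rfl
@[simp] theorem eval_and : (and c d).eval mat env = (c.eval mat env && d.eval mat env) := rfl
@[simp] theorem eval_or : (or c d).eval mat env = (c.eval mat env || d.eval mat env) := rfl

end

/-- The counters `x` and `y` are equal. -/
def eq (x y : Counter) : IndexTest := and (not (lt x y)) (not (lt y x))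

@[simp] theorem eval_eq {mat : List CopSymbol} {env : Counter → ℕ} {x y : Counter} :
    (eq x y).eval mat env = decide (env x = env y) := by
  rw [Bool.eq_iff_iff]
  simp only [eq, eval, Bool.and_eq_true, Bool.not_eq_true', decide_eq_false_iff_not, not_lt,
    decide_eq_true_eq]
  omega

/-- The counters `x` and `y` contain the indices of a vertex of `G'` of kind `t`. -/
def valid (x y : Counter) : VertexTag → IndexTest
  | .branch => lt y .k
  | .subdiv | .line => and (not (lt y x)) (not (entry x y .absent))
  | .rob => lt y .one
  | .reset => and (lt x .k) (lt y .one)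
  | .omega => and (lt x .one) (lt y .one)

/-- The vertices of `G'` of kinds `t` and `t'` whose indices are in the row counters and in the
column counters are joined by an unprotected edge. -/
def unprotected : VertexTag → VertexTag → IndexTest
  | .branch, .branch => eq .row .col
  | .branch, .subdiv => or (eq .row .col) (eq .row .col')
  | .subdiv, .branch => or (eq .col .row) (eq .col .row')
  | .subdiv, .subdiv => and (eq .row .col) (eq .row' .col')
  | .rob, .rob => not (entry .row .col .absent)
  | .line, .line => or (or (eq .row .col) (eq .row .col')) (or (eq .row' .col) (eq .row' .col'))
  | .rob, .line => or (eq .row .col) (eq .row .col')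
  | .line, .rob => or (eq .col .row) (eq .col .row')
  | .branch, .rob | .rob, .branch => entry .row .col .unprot
  | .subdiv, .rob | .rob, .subdiv => tt
  | .branch, .line => lt .row' .one
  | .line, .branch => lt .col' .one
  | .subdiv, .line | .line, .subdiv => not tt
  | .reset, .branch => eq .row .col'
  | .branch, .reset => eq .row' .col
  | .reset, .subdiv => lt .row .one
  | .subdiv, .reset => lt .col .one
  | .reset, _ | _, .reset => not tt
  | .omega, _ | _, .omega => tt

/-- The same for protected edges. -/
def protectedEdge : VertexTag → VertexTag → IndexTest
  | .branch, .rob | .rob, .branch => entry .row .col .prot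
  | .reset, .reset | .reset, .rob | .reset, .line | .rob, .reset | .line, .reset => tt
  | _, _ => not tt

end IndexTest

/-- The matrix of a graph, row by row and without markers. -/
def ProtGraph.entries {n : ℕ} (G : ProtGraph (Fin n)) : List CopSymbol :=
  (List.finRange n).flatMap fun u => (List.finRange n).map fun v => .entry (G.kind u v)

theorem ProtGraph.length_entries {n : ℕ} (G : ProtGraph (Fin n)) : G.entries.length = n * n := by
  simp [ProtGraph.entries, List.length_flatMap]

theorem List.getElem?_flatMap_of_length {α β : Type*} (l : List α) (f : α → List β) (n : ℕ)
    (hf : ∀ a ∈ l, (f a).length = n) (i j : ℕ) (hj : j < n) :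
    (l.flatMap f)[i * n + j]? = l[i]?.bind fun a => (f a)[j]? := by
  induction l generalizing i with
  | nil => simp
  | cons a l ih =>
    have ha : (f a).length = n := hf a (by simp)
    rw [List.flatMap_cons]
    cases i with
    | zero => rw [List.getElem?_append_left (by omega)]; simp
    | succ i =>
      rw [List.getElem?_append_right (by rw [ha, Nat.add_mul]; omega), ha,
        show (i + 1) * n + j - n = i * n + j by rw [Nat.add_mul]; omega,
        ih (fun b hb => hf b (by simp [hb]))]
      simp

theorem ProtGraph.getElem?_entries {n : ℕ} (G : ProtGraph (Fin n)) (u v : Fin n) :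
    G.entries[u.val * n + v.val]? = some (.entry (G.kind u v)) := by
  unfold ProtGraph.entries
  rw [List.getElem?_flatMap_of_length _ _ n (by simp) _ _ v.2]
  simp

/-- The counters contain the constants belonging to an instance. -/
structure IsConstEnv (n k : ℕ) (env : Counter → ℕ) : Prop where
  n_eq : env .n = n
  k_eq : env .k = k
  one_eq : env .one = 1

namespace IndexTest

variable {n k : ℕ} {G : ProtGraph (Fin n)} {env : Counter → ℕ}

theorem eval_entry (hn : env .n = n) {x y : Counter} {u v : Fin n} (hx : env x = u)
    (hy : env y = v) (a : EdgeKind) :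
    (entry x y a).eval G.entries env = decide (G.kind u v = a) := by
  simp [eval, hn, hx, hy, G.getElem?_entries]

theorem eval_valid (henv : IsConstEnv n k env) (h0 : 0 < n) (hk : k ≤ n) {x y : Counter}
    {i j : Fin n} (hx : env x = i) (hy : env y = j) (t : VertexTag) :
    (valid x y t).eval G.entries env = true ↔
      ∃ a : G.GadgetVertex k, a.code h0 hk = (t, i, j) := by
  have hedge : (and (not (lt y x)) (not (entry x y .absent))).eval G.entries env = true ↔
      ∃ e : G.edgeSet, e.1.inf = i ∧ e.1.sup = j := by
    simp only [eval_and, eval_not, eval_lt, eval_entry henv.n_eq hx hy, hx, hy, Bool.and_eq_true,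
      Bool.not_eq_true', decide_eq_false_iff_not, not_lt, Fin.val_fin_le]
    constructor
    · rintro ⟨h1, h2⟩
      exact ⟨⟨s(i, j), mk_mem_edgeSet.2 (by simpa [Adj] using h2)⟩, by simp [h1], by simp [h1]⟩
    · rintro ⟨e, rfl, rfl⟩
      refine ⟨e.1.inf_le_sup, ?_⟩
      have := e.2
      rw [Sym2.eq_mk_inf_sup e.1, mk_mem_edgeSet] at this
      simpa [Adj] using this
  cases t with
  | subdiv =>
    refine hedge.trans ⟨fun ⟨e, h1, h2⟩ => ⟨.subdiv e, by simp [GadgetVertex.code, h1, h2]⟩, ?_⟩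
    rintro ⟨a, ha⟩
    cases a <;> simp [GadgetVertex.code] at ha
    exact ⟨_, ha⟩
  | line =>
    refine hedge.trans ⟨fun ⟨e, h1, h2⟩ => ⟨.line e, by simp [GadgetVertex.code, h1, h2]⟩, ?_⟩
    rintro ⟨a, ha⟩
    cases a <;> simp [GadgetVertex.code] at ha
    exact ⟨_, ha⟩
  | branch =>
    simp only [valid, eval, hy, henv.k_eq, decide_eq_true_eq]
    refine ⟨fun h => ⟨.branch i ⟨j, h⟩, rfl⟩, ?_⟩
    rintro ⟨a, ha⟩
    cases a <;> simp [GadgetVertex.code] at ha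
    rw [← ha.2]
    simp
  | rob =>
    simp only [valid, eval, hy, henv.one_eq, decide_eq_true_eq, Nat.lt_one_iff]
    refine ⟨fun h => ⟨.rob i, by simp [GadgetVertex.code, Fin.ext_iff, h]⟩, ?_⟩
    rintro ⟨a, ha⟩
    cases a <;> simp [GadgetVertex.code] at ha
    simp [← ha.2]
  | reset =>
    simp only [valid, eval, hx, hy, henv.one_eq, henv.k_eq, decide_eq_true_eq, Nat.lt_one_iff,
      Bool.and_eq_true]
    refine ⟨fun h => ⟨.reset ⟨i, h.1⟩, by simp [GadgetVertex.code, Fin.ext_iff, h.2]⟩, ?_⟩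
    rintro ⟨a, ha⟩
    cases a <;> simp [GadgetVertex.code] at ha
    simp [← ha.1, ← ha.2]
  | omega =>
    simp only [valid, eval, hx, hy, henv.one_eq, decide_eq_true_eq, Nat.lt_one_iff,
      Bool.and_eq_true]
    refine ⟨fun h => ⟨.omega, by simp [GadgetVertex.code, Fin.ext_iff, h.1, h.2]⟩, ?_⟩
    rintro ⟨a, ha⟩
    cases a <;> simp [GadgetVertex.code] at ha
    simp [← ha.1, ← ha.2]

/-- The tests find out the kind of a pair of vertices of `G'`. -/
theorem kind_eq (henv : IsConstEnv n k env) (h0 : 0 < n) (hk : k ≤ n) {a b : G.GadgetVertex k}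
    (h1 : env .row = (a.code h0 hk).2.1) (h2 : env .row' = (a.code h0 hk).2.2)
    (h3 : env .col = (b.code h0 hk).2.1) (h4 : env .col' = (b.code h0 hk).2.2) :
    (if (unprotected (a.code h0 hk).1 (b.code h0 hk).1).eval G.entries env then EdgeKind.unprot
      else if (protectedEdge (a.code h0 hk).1 (b.code h0 hk).1).eval G.entries env then .prot
      else .absent) = (G.gadget k).kind a b := by
  have hmem : ∀ (e : Sym2 (Fin n)) (v : Fin n), v ∈ e ↔ v.val = e.inf ∨ v.val = e.sup := by
    intro e v
    conv_lhs => rw [e.eq_mk_inf_sup, Sym2.mem_iff]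
    simp [Fin.ext_iff]
  have hext : ∀ e f : G.edgeSet, e = f ↔ e.1.inf.val = f.1.inf ∧ e.1.sup.val = f.1.sup := by
    intro e f
    rw [Subtype.ext_iff, ← Sym2.inf_eq_inf_and_sup_eq_sup, Fin.ext_iff, Fin.ext_iff]
  have hshare : ∀ e f : Sym2 (Fin n), (∃ v, v ∈ e ∧ v ∈ f) ↔
      (e.inf.val = f.inf ∨ e.inf.val = f.sup) ∨ e.sup.val = f.inf ∨ e.sup.val = f.sup := by
    intro e f
    simp only [hmem, ← Fin.ext_iff, or_and_right, exists_or, exists_eq_left]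
  have hone := henv.one_eq
  cases a <;> cases b <;> simp only [GadgetVertex.code, Fin.val_castLE] at h1 h2 h3 h4
  case rob.rob =>
    have hentry := eval_entry (G := G) henv.n_eq h1 h3
    simp only [GadgetVertex.code, unprotected, protectedEdge, gadget, gadgetKind, hentry, Adj,
      eval_not, eval_tt]
    split_ifs <;> simp_all
  case branch.rob | rob.branch =>
    have hentry := eval_entry (G := G) henv.n_eq h1 h3
    simp only [GadgetVertex.code, unprotected, protectedEdge, gadget, gadgetKind, hentry]
    generalize G.kind _ _ = c
    cases c <;> rfl
  all_goals
    simp [GadgetVertex.code, unprotected, protectedEdge, gadget, gadgetKind, hshare,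
      h1, h2, h3, h4, hone, Fin.ext_iff]
  all_goals simp only [hmem, hext]

end IndexTest

open ProtGraph

namespace Generator

/-- Write the entry of the matrix belonging to an edge with given tests for protection. -/
def emitEntry (c d : IndexTest) : Generator :=
  cond c (emit (.entry .unprot)) (cond d (emit (.entry .prot)) (emit (.entry .absent)))

theorem text_emitEntry {mat : List CopSymbol} {env : Counter → ℕ} {c d : IndexTest} :
    (emitEntry c d).text mat env = [.entry (if c.eval mat env then .unprot
      else if d.eval mat env then .prot else .absent)] := by
  simp only [emitEntry, text]
  split_ifs <;> rfl

/-- Run a generator for all vertices of `G'`, with their indices in the counters `x` and `y`. -/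
def overVertices (x y : Counter) (g : VertexTag → Generator) : Generator :=
  let h : VertexTag → Generator := fun t =>
    loop x (loop y (cond (IndexTest.valid x y t) (g t) nop))
  seq (h .branch) (seq (h .subdiv) (seq (h .rob) (seq (h .line) (seq (h .reset) (h .omega)))))

theorem flatMap_filterMap {α β γ : Type*} (l : List α) (d : α → Option β) (f : β → List γ) :
    (l.filterMap d).flatMap f = l.flatMap fun c => ((d c).map f).getD [] := by
  induction l with
  | nil => rfl
  | cons a l ih => cases h : d a <;> simp [h, ih]

theorem text_overVertices {n k : ℕ} {G : ProtGraph (Fin n)} {env : Counter → ℕ}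
    (henv : IsConstEnv n k env) (h0 : 0 < n) (hk : k ≤ n) {x y : Counter}
    (hx : x ≠ .n ∧ x ≠ .k ∧ x ≠ .one) (hy : y ≠ .n ∧ y ≠ .k ∧ y ≠ .one) (hxy : x ≠ y)
    (g : VertexTag → Generator) (f : G.GadgetVertex k → List CopSymbol)
    (hf : ∀ a : G.GadgetVertex k, (g (a.code h0 hk).1).text G.entries
      (Function.update (Function.update env x (a.code h0 hk).2.1) y (a.code h0 hk).2.2) = f a) :
    (overVertices x y g).text G.entries env = (G.gadgetVertices h0 hk).flatMap f := by
  have hall : (overVertices x y g).text G.entries env = VertexTag.all.flatMap fun t =>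
      (loop x (loop y (cond (IndexTest.valid x y t) (g t) nop))).text G.entries env := by
    simp [overVertices, text, VertexTag.all]
  rw [hall, gadgetVertices, flatMap_filterMap, VertexCode.all, List.flatMap_assoc]
  congr 1
  funext t
  simp only [text, henv.n_eq, Function.update_of_ne hx.1.symm,
    ← List.map_coe_finRange_eq_range, List.flatMap_map, List.flatMap_assoc]
  congr 1
  funext i
  congr 1
  funext j
  let env' := Function.update (Function.update env x i.val) y j.val
  have henv' : IsConstEnv n k env' :=
    ⟨by simp [env', hx.1.symm, hy.1.symm, henv.n_eq],
      by simp [env', hx.2.1.symm, hy.2.1.symm, henv.k_eq],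
      by simp [env', hx.2.2.symm, hy.2.2.symm, henv.one_eq]⟩
  have hvalid := IndexTest.eval_valid (G := G) henv' h0 hk (x := x) (y := y) (i := i) (j := j)
    (by simp [env', hxy]) (by simp [env']) t
  have hinv := (GadgetVertex.code_injective (G := G) (k := k) h0 hk).isPartialInv
  by_cases h : ∃ a : G.GadgetVertex k, a.code h0 hk = (t, i, j)
  · rw [if_pos (hvalid.2 h)]
    obtain ⟨a, ha⟩ := h
    rw [← ha, hinv.eq, Option.map_some, Option.getD_some, ← hf a, ha]
  · rw [if_neg fun h' => h (hvalid.1 h')]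
    cases hc : Function.partialInv (GadgetVertex.code (G := G) (k := k) h0 hk) (t, i, j) with
    | none => rfl
    | some a => exact absurd ⟨a, (hinv _ _).1 hc⟩ h

/-- Write the matrix of `G'`. -/
def gadgetMatrix : Generator :=
  overVertices .row .row' fun t =>
    seq (overVertices .col .col' fun t' =>
      emitEntry (IndexTest.unprotected t t') (IndexTest.protectedEdge t t')) (emit .endRow)

/-- Write the matrix of `G`. -/
def inputMatrix : Generator :=
  loop .row (seq (loop .col
    (emitEntry (.entry .row .col .unprot) (.entry .row .col .prot))) (emit .endRow))

/-- Write the matrix of the output graph of the reduction. -/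
def outputMatrix : Generator :=
  cond (.and (.lt .one .k) (.not (.lt .n .k))) gadgetMatrix inputMatrix

theorem text_gadgetMatrix {n k : ℕ} (G : ProtGraph (Fin n)) {env : Counter → ℕ}
    (henv : IsConstEnv n k env) (h0 : 0 < n) (hk : k ≤ n) :
    gadgetMatrix.text G.entries env = (G.gadgetVertices (k := k) h0 hk).flatMap fun a =>
      (G.gadgetVertices h0 hk).map (fun b => .entry ((G.gadget k).kind a b)) ++ [.endRow] := by
  refine text_overVertices henv h0 hk (by simp) (by simp) (by simp) _ _ fun a => ?_
  let env' := Function.update (Function.update env .row (a.code h0 hk).2.1.val) .row'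
    (a.code h0 hk).2.2.val
  have henv' : IsConstEnv n k env' :=
    ⟨by simp [env', henv.n_eq], by simp [env', henv.k_eq], by simp [env', henv.one_eq]⟩
  rw [text, text, ← List.flatMap_singleton' (List.map _ _), List.flatMap_map]
  congr 1
  refine text_overVertices henv' h0 hk (by simp) (by simp) (by simp) _ _ fun b => ?_
  rw [text_emitEntry, IndexTest.kind_eq (a := a) (b := b)]
  · exact ⟨by simp [henv'.n_eq], by simp [henv'.k_eq], by simp [henv'.one_eq]⟩
  all_goals simp [env']

theorem text_inputMatrix {n : ℕ} (G : ProtGraph (Fin n)) {env : Counter → ℕ} (hn : env .n = n) :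
    inputMatrix.text G.entries env = (List.finRange n).flatMap fun u =>
      (List.finRange n).map (fun v => .entry (G.kind u v)) ++ [.endRow] := by
  simp only [inputMatrix, text, text_emitEntry, hn, ← List.map_coe_finRange_eq_range,
    List.flatMap_map]
  congr 1
  funext u
  have hn' : Function.update env .row u.val .n = n := by simp [hn]
  rw [hn', ← List.flatMap_singleton' (List.map (fun v => CopSymbol.entry (G.kind u v)) _),
    List.flatMap_map]
  congr 2
  funext v
  have h := IndexTest.eval_entry (G := G)
    (env := Function.update (Function.update env .row u.val) .col v.val) (by simp [hn])
    (x := .row) (y := .col) (u := u) (v := v) (by simp) (by simp)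
  rw [h, h]
  generalize G.kind u v = c
  cases c <;> rfl

/-- As far as the matrix is concerned, the text produced is the encoding of the value of the
reduction. If `k` exceeds `n`, its precise value does not matter. -/
theorem encode_gadgetReduction (x : CopInstance) {env : Counter → ℕ} {k : ℕ}
    (henv : IsConstEnv x.n k env) (hle : x.k ≤ x.n → k = x.k) (hlt : x.n < x.k → x.n < k) :
    (gadgetReduction x).encode = (Computability.encodeNat x.k).map .bit ++
      outputMatrix.text x.graph.entries env := by
  have heval : (IndexTest.and (.lt .one .k) (.not (.lt .n .k))).eval x.graph.entries env = true ↔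
      2 ≤ x.k ∧ x.k ≤ x.n := by
    simp only [IndexTest.eval_and, IndexTest.eval_not, IndexTest.eval_lt, henv.n_eq, henv.k_eq,
      henv.one_eq, Bool.and_eq_true, decide_eq_true_eq, Bool.not_eq_true', decide_eq_false_iff_not]
    omega
  rw [outputMatrix, text]
  by_cases h : 2 ≤ x.k ∧ x.k ≤ x.n
  · obtain rfl := hle h.2
    rw [if_pos (heval.2 h), gadgetReduction_of_le h.1 h.2,
      text_gadgetMatrix x.graph henv (by omega) h.2]
    unfold CopInstance.encode
    simp only [numberedGadget]
    congr 1
    generalize gadgetVertices x.graph _ _ = L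
    have hflat : ∀ F : _ → List CopSymbol,
        L.flatMap F = (List.finRange L.length).flatMap fun u => F (L.get u) := by
      intro F
      conv_lhs => rw [← List.map_get_finRange L]
      exact List.flatMap_map _ _ _
    have hmap : ∀ F : _ → CopSymbol,
        L.map F = (List.finRange L.length).map fun u => F (L.get u) := by
      intro F
      conv_lhs => rw [← List.map_get_finRange L]
      exact List.map_map
    rw [hflat]
    simp only [hmap]
  · rw [if_neg fun h' => h (heval.1 h'), gadgetReduction_of_not h, text_inputMatrix _ henv.n_eq]
    rfl

theorem wf_outputMatrix : outputMatrix.WF [.n, .k, .one, .aux, .aux'] := by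
  decide

end Generator

open ProtGraph StackProg

/-! ### Reading the input -/

/-- Separate the digits of `k` from the entries of the matrix, and count the rows. Both stacks end up
reversed, with the most significant digit of `k` on top. -/
def parseInput : CopProg :=
  loop .inp (ite (fun r => r = some .endRow) (inc .n)
    (ite (fun r => r = some (.bit true) ∨ r = some (.bit false))
      (push .bits' fun r => r.getD .endRow) (push .mat' fun r => r.getD .endRow)))

/-- The symbol is a binary digit. -/
def CopSymbol.isBit : CopSymbol → Bool
  | bit _ => true
  | _ => false

/-- The symbol is an entry of the matrix. -/
def CopSymbol.isEntry : CopSymbol → Bool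
  | entry _ => true
  | _ => false

@[simp] theorem CopSymbol.isBit_bit (b : Bool) : (bit b).isBit = true := rfl
@[simp] theorem CopSymbol.isBit_entry (a : EdgeKind) : (entry a).isBit = false := rfl
@[simp] theorem CopSymbol.isBit_endRow : endRow.isBit = false := rfl
@[simp] theorem CopSymbol.isEntry_bit (b : Bool) : (bit b).isEntry = false := rfl
@[simp] theorem CopSymbol.isEntry_entry (a : EdgeKind) : (entry a).isEntry = true := rfl
@[simp] theorem CopSymbol.isEntry_endRow : endRow.isEntry = false := rfl

theorem runs_parseInput (m : Memory) :
    Runs parseInput m.store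
      { m with
        inp := []
        bits' := (m.inp.filter CopSymbol.isBit).reverse ++ m.bits'
        mat' := (m.inp.filter CopSymbol.isEntry).reverse ++ m.mat'
        cnt := Function.update m.cnt .n (m.cnt .n + m.inp.count CopSymbol.endRow) }.store
      (m.inp.length * 4 + 1) := by
  generalize hl : m.inp = l
  induction l generalizing m with
  | nil =>
    intro r
    refine ⟨none, 1, by simp, ?_⟩
    have h : Exec parseInput r m.store none m.store 1 := .loop_nil hl
    convert! h using 2
    cases m
    simp_all
  | cons s l ih =>
    intro r
    let m' : Memory :=
      { m with
        inp := l
        bits' := ([s].filter CopSymbol.isBit).reverse ++ m.bits'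
        mat' := ([s].filter CopSymbol.isEntry).reverse ++ m.mat'
        cnt := Function.update m.cnt .n (m.cnt .n + [s].count CopSymbol.endRow) }
    have hbody : RunsFrom (ite (fun r => r = some .endRow) (inc .n)
        (ite (fun r => r = some (.bit true) ∨ r = some (.bit false))
        (push .bits' fun r => r.getD .endRow) (push .mat' fun r => r.getD .endRow))) (some s)
        { m with inp := l }.store m'.store 3 := by
      refine RunsFrom.ite (t := 2) ?_
      cases s with
      | endRow =>
        rw [if_pos (by simp)]
        refine RunsFrom.mono (t := 1) ?_ (by omega)
        have h := RunsFrom.inc .n { m with inp := l } (r := some CopSymbol.endRow)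
        simpa [m', List.filter_cons] using h
      | bit b =>
        rw [if_neg (by simp)]
        refine RunsFrom.ite (t := 1) ?_
        rw [if_pos (by cases b <;> simp)]
        have h := RunsFrom.push (k := StackName.bits') (f := fun r => r.getD .endRow)
          (r := some (CopSymbol.bit b)) (S := { m with inp := l }.store)
        simpa [m', List.filter_cons] using h
      | entry a =>
        rw [if_neg (by simp)]
        refine RunsFrom.ite (t := 1) ?_
        rw [if_neg (by simp)]
        have h := RunsFrom.push (k := StackName.mat') (f := fun r => r.getD .endRow)
          (r := some (CopSymbol.entry a)) (S := { m with inp := l }.store)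
        simpa [m', List.filter_cons] using h
    obtain ⟨r', t, ht, h1⟩ := hbody
    obtain ⟨r'', t', ht', h2⟩ := ih m' rfl r'
    rw [← Memory.update_inp] at h1
    refine ⟨r'', 1 + (t + t'), by simp only [List.length_cons]; omega,
      .loop_cons (show m.store .inp = _ from hl) h1 ?_⟩
    convert! h2 using 3
    · cases s <;> simp [m', List.filter_cons]
    · cases s <;> simp [m', List.filter_cons]
    · cases s <;> simp [m', Nat.add_assoc, Nat.add_comm]

namespace CopInstance

variable (x : CopInstance)

theorem filter_isBit_encode :
    x.encode.filter CopSymbol.isBit = (Computability.encodeNat x.k).map .bit := by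
  unfold encode
  rw [List.filter_append, List.filter_eq_self.2 (by
    intro s hs
    obtain ⟨b, -, rfl⟩ := List.mem_map.1 hs
    rfl),
    List.filter_eq_nil_iff.2, List.append_nil]
  simp only [List.mem_flatMap, List.mem_append, List.mem_map, List.mem_singleton]
  rintro s ⟨u, -, ⟨v, -, rfl⟩ | rfl⟩ <;> simp

theorem filter_isEntry_encode : x.encode.filter CopSymbol.isEntry = x.graph.entries := by
  unfold encode
  rw [List.filter_append, List.filter_eq_nil_iff.2 (by
    intro s hs
    obtain ⟨b, -, rfl⟩ := List.mem_map.1 hs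
    exact Bool.false_ne_true), List.nil_append,
    List.filter_flatMap]
  unfold ProtGraph.entries
  congr 1
  funext u
  rw [List.filter_append, List.filter_eq_self.2 (by
    intro s hs
    obtain ⟨b, -, rfl⟩ := List.mem_map.1 hs
    rfl)]
  simp

theorem count_endRow_encode : x.encode.count CopSymbol.endRow = x.n := by
  unfold encode
  rw [List.count_append, List.count_eq_zero.2 (by simp), List.count_flatMap]
  have : ∀ u : Fin x.n, List.count CopSymbol.endRow
      ((List.finRange x.n).map (fun v => CopSymbol.entry (x.graph.kind u v)) ++ [.endRow]) = 1 := by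
    intro u
    rw [List.count_append, List.count_eq_zero.2 (by simp)]
    simp
  simp [Function.comp_def, this]

theorem length_encode :
    x.encode.length = (Computability.encodeNat x.k).length + x.n * (x.n + 1) := by
  simp [encode, List.length_flatMap]

end CopInstance

/-! ### Computing the number of cops in unary -/

/-- The number with given binary digits, the least significant one first. -/
def binaryValue (l : List Bool) : ℕ := l.foldr (fun b s => 2 * s + b.toNat) 0

theorem binaryValue_encodeNat (k : ℕ) : binaryValue (Computability.encodeNat k) = k := by
  have hpos : ∀ p : PosNum, binaryValue (Computability.encodePosNum p) = (p : ℕ) := by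
    intro p
    induction p with
    | one => rfl
    | bit0 p ih =>
      simp only [binaryValue, Computability.encodePosNum, List.foldr_cons, PosNum.cast_bit0] at *
      rw [ih]
      simp
      omega
    | bit1 p ih =>
      simp only [binaryValue, Computability.encodePosNum, List.foldr_cons, PosNum.cast_bit1] at *
      rw [ih]
      simp
      omega
  have hnum : ∀ m : Num, binaryValue (Computability.encodeNum m) = (m : ℕ) := by
    intro m
    cases m with
    | zero => rfl
    | pos p => exact hpos p
  rw [Computability.encodeNat, hnum, Num.to_of_nat]

/-- One step of Horner's scheme, omitted if the number already exceeds `n`. This keeps the unary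
representation polynomially long. -/
def cappedStep (n : ℕ) (s : ℕ) (b : Bool) : ℕ := if n < s then s else 2 * s + b.toNat

theorem cappedStep_le {n s : ℕ} (hs : s ≤ 2 * n + 1) (b : Bool) : cappedStep n s b ≤ 2 * n + 1 := by
  unfold cappedStep
  split_ifs
  · exact hs
  · cases b <;> simp <;> omega

theorem foldl_cappedStep_le {n : ℕ} (l : List Bool) {s : ℕ} (hs : s ≤ 2 * n + 1) :
    l.foldl (cappedStep n) s ≤ 2 * n + 1 := by
  induction l generalizing s with
  | nil => exact hs
  | cons b l ih => exact ih (cappedStep_le hs b)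

/-- The capped value of a number is correct if it is at most `n`, and exceeds `n` otherwise. -/
theorem cappedValue_spec (n : ℕ) (l : List Bool) :
    (binaryValue l ≤ n → l.reverse.foldl (cappedStep n) 0 = binaryValue l) ∧
      (n < binaryValue l → n < l.reverse.foldl (cappedStep n) 0) := by
  induction l with
  | nil => simp [binaryValue]
  | cons b l ih =>
    rw [List.reverse_cons, List.foldl_append]
    have hval : binaryValue (b :: l) = 2 * binaryValue l + b.toNat := rfl
    rw [hval]
    simp only [List.foldl_cons, List.foldl_nil, cappedStep]
    split_ifs <;> omega

/-- Double the counter `k` and add a binary digit. -/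
def doubleAdd (b : Bool) : CopProg :=
  loop (.cnt .k) (inc .aux ;; inc .aux) ;; pour (.cnt .aux) (.cnt .k) ;;
    if b then inc .k else clear

theorem runs_doubleAdd (b : Bool) {m : Memory} (haux : m.cnt .aux = 0) :
    Runs (doubleAdd b) m.store
      { m with cnt := Function.update m.cnt .k (2 * m.cnt .k + b.toNat) }.store
      (m.cnt .k * 7 + 3) := by
  let F : ℕ → Memory := fun i =>
    { m with cnt := Function.update (Function.update m.cnt .k i) .aux (2 * (m.cnt .k - i)) }
  have h1 := Runs.loop_cnt (x := .k) (p := inc .aux ;; inc .aux) (t := 2) F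
    (fun i => by simp [F]) (m.cnt .k) (by
      intro i hi
      refine RunsFrom.inc_seq (t := 1) ?_
      convert! RunsFrom.inc .aux _ using 3
      funext z
      simp only [F, Function.update_apply]
      split_ifs <;> simp_all
      omega)
  have hN : F (m.cnt .k) = m := by
    simp only [F]
    congr 1
    funext z
    simp only [Function.update_apply]
    split_ifs <;> simp_all
  rw [hN] at h1
  have h2 := Runs.pour_cnt (x := .aux) (y := .k) (by simp) (F 0)
  let m' : Memory := { m with cnt := Function.update m.cnt .k (2 * m.cnt .k) }
  have e2 : { F 0 with
      cnt := Function.update (Function.update (F 0).cnt .aux 0) .k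
        ((F 0).cnt .aux + (F 0).cnt .k) } = m' := by
    simp only [F, m']
    congr 1
    funext z
    simp only [Function.update_apply]
    split_ifs <;> simp_all
  rw [e2] at h2
  have h3 : Runs (if b then inc .k else clear) m'.store
      { m with cnt := Function.update m.cnt .k (2 * m.cnt .k + b.toNat) }.store 1 := by
    cases b with
    | true =>
      intro r
      have h := RunsFrom.inc .k m' (r := r)
      simpa [m', List.filter_cons] using h
    | false => exact Runs.clear
  refine (h1.seq (h2.seq h3)).mono ?_
  have : (F 0).cnt .aux = 2 * m.cnt .k := by simp [F]
  rw [this]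
  omega

/-- Horner's scheme for the counter `k`, capped as soon as the number exceeds `n`. The digits are kept
for the output. -/
def computeK : CopProg :=
  let step : Bool → CopProg := fun b => push .bits (fun r => r.getD .endRow) ;;
    (IndexTest.lt .n .k).compile clear (doubleAdd b)
  loop .bits' (ite (fun r => r = some (.bit true)) (step true) (step false))

theorem runs_computeK : ∃ P : Polynomial ℕ, ∀ (l : List Bool) (m : Memory) (B : ℕ), m.Tidy B →
    m.bits' = l.map CopSymbol.bit → m.cnt .k ≤ 2 * m.cnt .n + 1 → 2 * m.cnt .n + 1 ≤ B →
    Runs computeK m.store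
      { m with
        bits' := []
        bits := (l.map CopSymbol.bit).reverse ++ m.bits
        cnt := Function.update m.cnt .k (l.foldl (cappedStep (m.cnt .n)) (m.cnt .k)) }.store
      (l.length * P.eval B + 1) := by
  obtain ⟨P, hP⟩ := IndexTest.runs_compile (c := .lt .n .k) (by decide)
  refine ⟨P + 7 * Polynomial.X + 6, fun l => ?_⟩
  induction l with
  | nil =>
    intro m B _ hbits _ _ r
    refine ⟨none, 1, by simp, ?_⟩
    have h : Exec computeK r m.store none m.store 1 := .loop_nil hbits
    convert! h using 2
    cases m
    simp_all
  | cons b l ih =>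
    intro m B hm hbits hk hB r
    let m₁ : Memory := { m with bits' := l.map .bit, bits := .bit b :: m.bits }
    have hm₁ : m₁.Tidy B := ⟨hm.aux, hm.aux', hm.mat', hm.cnt_le, hm.mat_le⟩
    let m₂ : Memory := { m₁ with
      cnt := Function.update m.cnt .k (cappedStep (m.cnt .n) (m.cnt .k) b) }
    have hstep : Runs ((IndexTest.lt .n .k).compile clear (doubleAdd b)) m₁.store m₂.store
        (P.eval B + (B * 7 + 3)) := by
      refine hP _ _ m₁ _ B _ hm₁ ?_
      by_cases hlt : m.cnt .n < m.cnt .k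
      · have e : m₂ = m₁ := by
          simp only [m₂, cappedStep, if_pos hlt, Function.update_eq_self]
          rfl
        rw [if_pos (by simpa [m₁] using hlt), e]
        exact Runs.clear.mono (by omega)
      · rw [if_neg (by simpa [m₁] using hlt)]
        have h := runs_doubleAdd b (m := m₁) hm.aux
        have hkB := hm.cnt_le .k
        refine Runs.mono (t := m₁.cnt .k * 7 + 3) ?_ (by simp only [m₁]; omega)
        simpa [m₂, cappedStep, hlt, m₁] using h
    have hbody : RunsFrom (ite (fun r => r = some (.bit true))
        (push .bits (fun r => r.getD .endRow) ;;
          (IndexTest.lt .n .k).compile clear (doubleAdd true))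
        (push .bits (fun r => r.getD .endRow) ;;
          (IndexTest.lt .n .k).compile clear (doubleAdd false))) (some (.bit b))
        { m with bits' := l.map .bit }.store m₂.store (1 + (1 + (P.eval B + (B * 7 + 3)))) := by
      refine RunsFrom.ite ?_
      cases b with
      | true =>
        rw [if_pos (by simp)]
        refine RunsFrom.push_seq ?_
        rw [Memory.update_bits]
        exact hstep _
      | false =>
        rw [if_neg (by simp)]
        refine RunsFrom.push_seq ?_
        rw [Memory.update_bits]
        exact hstep _
    have hcap := cappedStep_le hk b
    have hm₂n : m₂.cnt .n = m.cnt .n := by simp [m₂]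
    have hm₂k : m₂.cnt .k = cappedStep (m.cnt .n) (m.cnt .k) b := by simp [m₂]
    have hm₂ : m₂.Tidy B := by
      refine ⟨by simp [m₂, hm.aux], by simp [m₂, hm.aux'], hm.mat', fun z => ?_, hm.mat_le⟩
      rcases eq_or_ne z .k with rfl | hz
      · rw [hm₂k]
        exact hcap.trans hB
      · simpa [m₂, hz] using hm.cnt_le z
    obtain ⟨r', t, ht, h1⟩ := hbody
    obtain ⟨r'', t', ht', h2⟩ := ih m₂ B hm₂ rfl (by rw [hm₂k, hm₂n]; exact hcap)
      (by rw [hm₂n]; exact hB) r'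
    rw [← Memory.update_bits'] at h1
    refine ⟨r'', 1 + (t + t'), ?_, .loop_cons (show m.store .bits' = .bit b :: l.map .bit from hbits) h1 ?_⟩
    · simp only [Polynomial.eval_add, Polynomial.eval_mul, Polynomial.eval_ofNat,
        Polynomial.eval_X, List.length_cons, Nat.add_mul, Nat.one_mul] at *
      omega
    · convert! h2 using 3
      · simp [m₂, m₁]
      · rw [hm₂n, hm₂k]
        simp [m₂]

/-! ### The reduction is computable in polynomial time -/

/-- The machine computing the reduction. -/
def reductionProgram : CopProg :=
  (parseInput ;; pour .mat' .mat ;; inc .one ;; computeK ;; Generator.outputMatrix.compile ;;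
    pour .bits .bits' ;; pour .bits' .out ;;
    empty .mat ;; empty (.cnt .n) ;; empty (.cnt .k) ;; empty (.cnt .one)) ;; clear

/-- The values of the counters outside of loops. -/
def constEnv (n k one : ℕ) : Counter → ℕ
  | .n => n
  | .k => k
  | .one => one
  | _ => 0

theorem gadgetReduction_computableInPolyTime : Nonempty
    (Turing.TM2ComputableInPolyTime CopInstance.encode CopInstance.encode gadgetReduction) := by
  obtain ⟨P, hP⟩ := runs_computeK
  obtain ⟨Q, hQ⟩ := Generator.runs_compile (by simp) (by simp) (by simp) Generator.wf_outputMatrix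
  -- Between the stages all counters are at most `2 * n + 1`, and `n` is at most the length of the input.
  refine computableInPolyTime reductionProgram .inp .out _ _ _
    ((Polynomial.X * P + Q + 20 * Polynomial.X + 20).comp (2 * Polynomial.X + 3)) fun x => ?_
  set len := x.encode.length with hlen
  have hlen' := x.length_encode
  let B := 2 * len + 3
  let bits : List CopSymbol := (Computability.encodeNat x.k).map .bit
  let mat := x.graph.entries
  have hbits : bits.length ≤ len := by simp only [bits, List.length_map]; omega
  have hmat : mat.length ≤ len := by
    simp only [mat, ProtGraph.length_entries]
    rw [hlen, hlen', Nat.mul_add]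
    omega
  have hn : x.n ≤ len := by
    rw [hlen, hlen', Nat.mul_add]
    omega
  let κ := (Computability.encodeNat x.k).reverse.foldl (cappedStep x.n) 0
  have hκ : κ ≤ 2 * x.n + 1 := foldl_cappedStep_le _ (by omega)
  have hspec := cappedValue_spec x.n (Computability.encodeNat x.k)
  rw [binaryValue_encodeNat] at hspec
  have hconst : IsConstEnv x.n κ (constEnv x.n κ 1) := ⟨rfl, rfl, rfl⟩
  let text := Generator.outputMatrix.text mat (constEnv x.n κ 1)
  have h1 : Runs parseInput (Memory.mk x.encode [] [] [] [] [] (constEnv 0 0 0)).store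
      (Memory.mk [] [] [] bits.reverse [] mat.reverse (constEnv x.n 0 0)).store (len * 4 + 1) := by
    convert! runs_parseInput (Memory.mk x.encode [] [] [] [] [] (constEnv 0 0 0)) using 3
    · simp [x.filter_isBit_encode, bits]
    · simp [x.filter_isEntry_encode, mat]
    · simp only [x.count_endRow_encode]
      funext z
      cases z <;> simp [constEnv]
  have h2 := Runs.pour (a := .mat') (b := .mat) (by simp)
    (Memory.mk [] [] [] bits.reverse [] mat.reverse (constEnv x.n 0 0)).store
  have h3 : Runs (inc .one) (Memory.mk [] [] [] bits.reverse mat [] (constEnv x.n 0 0)).store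
      (Memory.mk [] [] [] bits.reverse mat [] (constEnv x.n 0 1)).store 1 := by
    intro r
    convert! RunsFrom.inc .one _ using 3
    funext z
    cases z <;> simp [constEnv]
  have h4 : Runs computeK (Memory.mk [] [] [] bits.reverse mat [] (constEnv x.n 0 1)).store
      (Memory.mk [] [] bits [] mat [] (constEnv x.n κ 1)).store
      (bits.length * P.eval B + 1) := by
    have h := hP (Computability.encodeNat x.k).reverse
      (Memory.mk [] [] [] bits.reverse mat [] (constEnv x.n 0 1)) B
      ⟨rfl, rfl, rfl, fun z => by cases z <;> simp [constEnv, B]; omega, by simp [B]; omega⟩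
      (by simp [bits]) (by simp [constEnv]) (by simp [constEnv, B]; omega)
    convert! h using 3
    · simp [bits]
    · funext z
      cases z <;> simp [constEnv, κ]
    · simp [bits]
  have h5 := hQ (Memory.mk [] [] bits [] mat [] (constEnv x.n κ 1)) B
    ⟨rfl, rfl, rfl, fun z => by cases z <;> simp [constEnv, B] <;> omega, by simp [B]; omega⟩
    (by intro z hz; cases z <;> simp_all [constEnv])
  have h6 := Runs.pour (a := .bits) (b := .bits') (by simp)
    (Memory.mk [] text bits [] mat [] (constEnv x.n κ 1)).store
  have h7 := Runs.pour (a := .bits') (b := .out) (by simp)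
    (Memory.mk [] text [] bits.reverse mat [] (constEnv x.n κ 1)).store
  have h8 := Runs.empty (a := .mat)
    (Memory.mk [] (bits ++ text) [] [] mat [] (constEnv x.n κ 1)).store
  have h9 := Runs.empty_cnt .n (Memory.mk [] (bits ++ text) [] [] [] [] (constEnv x.n κ 1))
  have h10 := Runs.empty_cnt .k (Memory.mk [] (bits ++ text) [] [] [] [] (constEnv 0 κ 1))
  have h11 := Runs.empty_cnt .one (Memory.mk [] (bits ++ text) [] [] [] [] (constEnv 0 0 1))
  have e9 : Function.update (constEnv x.n κ 1) .n 0 = constEnv 0 κ 1 := by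
    funext z
    cases z <;> simp [constEnv]
  have e10 : Function.update (constEnv 0 κ 1) .k 0 = constEnv 0 0 1 := by
    funext z
    cases z <;> simp [constEnv]
  have e11 : Function.update (constEnv 0 0 1) .one 0 = constEnv 0 0 0 := by
    funext z
    cases z <;> simp [constEnv]
  simp only [Memory.store_mat, Memory.store_mat', Memory.update_mat, Memory.update_mat',
    List.reverse_reverse, List.append_nil, Memory.store_bits, Memory.store_bits',
    Memory.update_bits, Memory.update_bits', Memory.store_out, Memory.update_out, e9, e10, e11,
    List.length_reverse] at h2 h5 h6 h7 h8 h9 h10 h11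
  have hrun := h1.seq (h2.seq (h3.seq (h4.seq (h5.seq (h6.seq (h7.seq (h8.seq (h9.seq
    (h10.seq h11)))))))))
  obtain ⟨r, t, ht, hex⟩ := hrun none
  have hinit : (Memory.mk x.encode [] [] [] [] [] (constEnv 0 0 0)).store =
      Function.update (fun _ => []) .inp x.encode := by
    funext s
    cases s with
    | cnt z => cases z <;> simp [constEnv]
    | _ => simp
  have hfinal : (Memory.mk [] (bits ++ text) [] [] [] [] (constEnv 0 0 0)).store =
      Function.update (fun _ => []) .out (gadgetReduction x).encode := by
    rw [Generator.encode_gadgetReduction x hconst hspec.1 hspec.2]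
    funext s
    cases s with
    | cnt z => cases z <;> simp [constEnv]
    | _ => simp [bits, text, mat]
  have hex' := hex.seq .clear
  rw [hinit, hfinal] at hex'
  refine ⟨_, ?_, hex'⟩
  have hB : bits.length * P.eval B ≤ B * P.eval B := Nat.mul_le_mul_right _ (by simp [B]; omega)
  have hn' : constEnv x.n κ 1 .n = x.n := rfl
  have hκ' : constEnv 0 κ 1 .k = κ := rfl
  have hone : constEnv 0 0 1 .one = 1 := rfl
  simp only [hn', hκ', hone] at ht
  have hPB : (2 * Polynomial.X + 3 : Polynomial ℕ).eval len = B := by simp [B]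
  rw [Polynomial.eval_comp, hPB]
  simp only [Polynomial.eval_add, Polynomial.eval_mul, Polynomial.eval_X, Polynomial.eval_ofNat]
  have hBlen : B = 2 * len + 3 := rfl
  omega

theorem theorem2p2 :
    (∀ (V : Type*) [Finite V] (G : ProtGraph V) (k : ℕ), 2 ≤ k →
      (G.LazyCopsWin k ↔ (G.gadget k).CopsWin k)) ∧
    ∃ f : CopInstance → CopInstance,
      Nonempty (Turing.TM2ComputableInPolyTime CopInstance.encode CopInstance.encode f) ∧
      (∀ x, x ∈ CopInstance.LCRP ↔ f x ∈ CopInstance.CRP) ∧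
      (∀ x, (f x).k = x.k) ∧
      (∀ x, x.k = 1 → (f x).graph.Isomorphic x.graph) ∧
      (∀ x, 2 ≤ x.k → x.k ≤ x.n → (f x).graph.Isomorphic (x.graph.gadget x.k)) := by
  refine ⟨fun V _ G k hk => lazyCopsWin_iff_gadget hk, gadgetReduction,
    gadgetReduction_computableInPolyTime, mem_LCRP_iff_gadgetReduction, gadgetReduction_k,
    fun x hx => ?_, fun x h h' => gadgetReduction_isomorphic h h'⟩
  rw [gadgetReduction_of_not (by omega)]
  exact ⟨Equiv.refl _, fun _ _ => rfl⟩
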